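/- Let $\mathcal X,\mathcal Y$ be (real or complex) Hilbert spaces, let $A$ be the generator of a strongly continuous semigroup $e^{At}$ on $\mathcal X$ that is skew-adjoint, i.e. $\mathscr D(A^*)=\mathscr D(A)$ and $A+A^*=0$, and let $C:\mathcal X\to\mathcal Y$ be a bounded linear operator. Let $T>0$ and assume that the system is exactly observable at time $T$: there is $\delta>0$ with $$\int_0^T\|Ce^{At}x\|^2\,dt\ \ge\ \delta\|x\|^2\qquad\text{for all }x\in\mathcal X .$$ Let $f\in L^1(0,T;\mathcal X)$ (the load) and $y\in L^2(0,T;\mathcal Y)$ (the measured output) be given. For $x\in\mathcal X$ let $z[x](t)=e^{At}x+\int_0^te^{A(t-s)}f(s)\,ds$ be the mild solution of $\dot z=Az+f$, $z(0)=x$, and put $$J(x)=\frac12\int_0^T\|y(s)-Cz[x](s)\|^2\,ds .$$ Let $\kappa_j>0$ $(j=1,2,\dots)$ satisfy $\sum_{j}\kappa_j=\infty$ and $\sum_j\kappa_j^2<\infty$. The back and forth nudging (BFN) iterates with colocated feedback, for an arbitrary starting vector $z_1^+(0)\in\mathcal X$, are the (continuous, mild) solutions on $[0,T]$ of $$\dot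 z_j^+(t)=Az_j^+(t)+f(t)+\kappa_jC^*\big(y(t)-Cz_j^+(t)\big),\qquad z_j^+(0)=z_{j-1}^-(T)\ \ (j\ge2),$$ $$\dot z_j^-(t)=-Az_j^-(t)-f(T-t)+\kappa_jC^*\big(y(T-t)-Cz_j^-(t)\big),\qquad z_j^-(0)=z_j^+(T).$$ Then $J$ has a unique minimizer $x^o\in\mathcal X$, the operator $-A$ also generates a strongly continuous semigroup, the BFN iterates exist for every starting vector, and the initial-state estimates converge strongly to $x^o$: $\|z_j^+(0)-x^o\|\to0$ and $\|z_j^-(T)-x^o\|\to0$ as $j\to\infty$. -/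

import Mathlib

open MeasureTheory Filter Topology

/-- A strongly continuous one-parameter semigroup of bounded operators on `X`. Only the values at
times `t ≥ 0` are meaningful. -/
structure C0Semigroup (𝕜 X : Type*) [RCLike 𝕜] [NormedAddCommGroup X] [NormedSpace 𝕜 X] where
  toFun : ℝ → X →L[𝕜] X
  map_zero' : toFun 0 = ContinuousLinearMap.id 𝕜 X
  map_add' : ∀ s t : ℝ, 0 ≤ s → 0 ≤ t → toFun (s + t) = (toFun s).comp (toFun t)
  continuousOn' : ∀ x : X, ContinuousOn (fun t => toFun t x) (Set.Ici 0)

instance C0Semigroup.instCoeFun (𝕜 X : Type*) [RCLike 𝕜] [NormedAddCommGroup X]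
    [NormedSpace 𝕜 X] : CoeFun (C0Semigroup 𝕜 X) (fun _ => ℝ → X →L[𝕜] X) :=
  ⟨C0Semigroup.toFun⟩

/-- The (unbounded) operator `A` is the infinitesimal generator of `S`: `x` lies in the domain of
`A` with `A x = w` if and only if the right difference quotient of `t ↦ S t x` at `0` tends to
`w`. -/
def C0Semigroup.HasGenerator {𝕜 X : Type*} [RCLike 𝕜] [NormedAddCommGroup X] [NormedSpace 𝕜 X]
    (S : C0Semigroup 𝕜 X) (A : X →ₗ.[𝕜] X) : Prop :=
  ∀ x w : X, (x, w) ∈ A.graph ↔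
    Tendsto (fun t : ℝ => (t : 𝕜)⁻¹ • (S t x - x)) (𝓝[>] 0) (𝓝 w)

/-- A densely defined operator with `D(A*) = D(A)` and `A + A* = 0` on this common domain. -/
def IsSkewAdjointOp {𝕜 X : Type*} [RCLike 𝕜] [NormedAddCommGroup X] [InnerProductSpace 𝕜 X]
    [CompleteSpace X] (A : X →ₗ.[𝕜] X) : Prop :=
  Dense (A.domain : Set X) ∧ A.adjoint.domain = A.domain ∧
    ∀ (x : X) (hx : x ∈ A.domain) (hx' : x ∈ A.adjoint.domain), A ⟨x, hx⟩ + A.adjoint ⟨x, hx'⟩ = 0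

/-- `z` is a mild solution on `[0,T]` of `ż = B z + g`, where `B` generates `S`:
`z(t) = S(t) z(0) + ∫₀ᵗ S(t-s) g(s) ds`. (The inhomogeneity `g` may itself involve `z`.) -/
structure IsMildSolution {𝕜 X : Type*} [RCLike 𝕜] [NormedAddCommGroup X] [NormedSpace 𝕜 X]
    [NormedSpace ℝ X] (S : C0Semigroup 𝕜 X) (T : ℝ) (g : ℝ → X) (z : ℝ → X) : Prop where
  continuousOn : ContinuousOn z (Set.Icc 0 T)
  integrable : IntervalIntegrable g volume 0 T
  eq : ∀ t ∈ Set.Icc 0 T, z t = S t (z 0) + ∫ s in (0 : ℝ)..t, S (t - s) (g s)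

/-- The (mild) solution `z[x]` of the open-loop system `ż = A z + f`, `z(0) = x`, where `A`
generates `S`. -/
noncomputable def openLoop {𝕜 X : Type*} [RCLike 𝕜] [NormedAddCommGroup X] [NormedSpace 𝕜 X]
    [NormedSpace ℝ X] (S : C0Semigroup 𝕜 X) (f : ℝ → X) (x : X) (t : ℝ) : X :=
  S t x + ∫ s in (0 : ℝ)..t, S (t - s) (f s)

/-- The output-error functional `J(x) = ½ ∫₀ᵀ ‖y(s) - C z[x](s)‖² ds`. -/
noncomputable def outputCost {𝕜 X Y : Type*} [RCLike 𝕜] [NormedAddCommGroup X] [NormedSpace 𝕜 X]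
    [NormedSpace ℝ X] [NormedAddCommGroup Y] [NormedSpace 𝕜 Y]
    (S : C0Semigroup 𝕜 X) (C : X →L[𝕜] Y) (T : ℝ) (f : ℝ → X) (y : ℝ → Y) (x : X) : ℝ :=
  (1 / 2) * ∫ s in (0 : ℝ)..T, ‖y s - C (openLoop S f x s)‖ ^ 2

/-- `zp j`, `zm j` are the forward and backward observers of step `j + 1` (`j = 0, 1, 2, …`) of
back and forth nudging with colocated feedback and gain `κ j`, started at `x₁`. Here `S` is the
semigroup generated by `A` and `Sm` the one generated by `-A`. -/
structure IsBFN {𝕜 X Y : Type*} [RCLike 𝕜] [NormedAddCommGroup X] [InnerProductSpace 𝕜 X]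
    [CompleteSpace X] [NormedSpace ℝ X] [NormedAddCommGroup Y] [InnerProductSpace 𝕜 Y]
    [CompleteSpace Y] (S Sm : C0Semigroup 𝕜 X) (C : X →L[𝕜] Y) (T : ℝ) (f : ℝ → X) (y : ℝ → Y)
    (κ : ℕ → ℝ) (x₁ : X) (zp zm : ℕ → ℝ → X) : Prop where
  forward : ∀ j, IsMildSolution S T
    (fun t => f t + (κ j : 𝕜) • ContinuousLinearMap.adjoint C (y t - C (zp j t))) (zp j)
  backward : ∀ j, IsMildSolution Sm T
    (fun t => -f (T - t) + (κ j : 𝕜) • ContinuousLinearMap.adjoint C (y (T - t) - C (zm j t)))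
    (zm j)
  forward_first : zp 0 0 = x₁
  forward_init : ∀ j, zp (j + 1) 0 = zm j T
  backward_init : ∀ j, zm j 0 = zp j T

/-! ### Skew-adjoint generators: isometric semigroups and their adjoints. -/

section SkewAdjoint

variable {𝕜 X : Type*} [RCLike 𝕜] [NormedAddCommGroup X]

/-! Skew-adjointness makes `S` a semigroup of isometries whose adjoint is generated by `-A`; the two
glue to a unitary group `U`. Conjugating by `U (-t)` removes the unbounded generator: all that
remains are integral equations with the bounded kernel `K s = U (-s) C* C U s`, the Gramian density.
Exact observability says precisely that the Gramian `G = ∫ K` is coercive.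

The minimizer `xo` solves the normal equation: with `h s = U (-s) C* (y s - C (zo s))` and `zo` the
trajectory from `xo`, it reads `∫ h = 0`. The cost then exceeds its value at `xo` by half the
observed energy of `x - xo`, which is coercive.

For an observer `z` with gain `κ`, the error `w t = U (-t) (z t - zo t)` satisfies `w' = κ (h - K
w)`. Since `w - w 0 = O(κ)` and `∫ h = 0`, one sweep gives `w T = w 0 - κ G (w 0) + O(κ²)`, hence
`‖w T‖ ≤ (1 - c κ) ‖w 0‖ + D κ²` (`exists_norm_le_of_nudging`). The measurement may be inconsistent
with every trajectory: optimality of `xo` alone cancels the first-order forcing. A backward sweep is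
a forward sweep for the reversed group. With `∑ κ = ∞` and `∑ κ² < ∞` the scalar recursion forces
the error to zero (`tendsto_zero_of_le_one_sub_mul_add`). -/

theorem RCLike.ofReal_smul_eq_real_smul [NormedSpace 𝕜 X] [NormedSpace ℝ X] (r : ℝ) (x : X) :
    (r : 𝕜) • x = r • x :=
  -- The real structure is not assumed to be restricted from `𝕜`; the two agree because a
  -- topological vector space carries only one continuous real scalar action.
  algebraMap_smul 𝕜 r x

theorem LinearPMap.mem_neg_graph_iff [NormedSpace 𝕜 X] {A : X →ₗ.[𝕜] X} {x w : X} :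
    (x, w) ∈ (-A).graph ↔ (x, -w) ∈ A.graph := by
  simp only [LinearPMap.mem_graph_iff, LinearPMap.neg_apply]
  exact ⟨fun ⟨y, h1, h2⟩ => ⟨y, h1, by rw [← h2, neg_neg]⟩,
    fun ⟨y, h1, h2⟩ => ⟨y, h1, by rw [h2, neg_neg]⟩⟩

namespace C0Semigroup

section Normed

variable [NormedSpace 𝕜 X] {S : C0Semigroup 𝕜 X} {A : X →ₗ.[𝕜] X}

theorem HasGenerator.apply_mem_graph (hS : S.HasGenerator A) {x w : X} (h : (x, w) ∈ A.graph)
    {t : ℝ} (ht : 0 ≤ t) : (S t x, S t w) ∈ A.graph := by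
  rw [hS]
  refine (((S t).continuous.tendsto w).comp ((hS x w).1 h)).congr' ?_
  filter_upwards [self_mem_nhdsWithin] with r hr
  have h1 : S r (S t x) = S t (S r x) := by
    rw [← ContinuousLinearMap.comp_apply, ← S.map_add' r t (le_of_lt hr) ht, add_comm,
      S.map_add' t r ht (le_of_lt hr)]
    rfl
  simp [h1]

theorem HasGenerator.hasDerivWithinAt [NormedSpace ℝ X] (hS : S.HasGenerator A) {x w : X}
    (h : (x, w) ∈ A.graph) {t : ℝ} (ht : 0 ≤ t) :
    HasDerivWithinAt (fun s => S s x) (S t w) (Set.Ici t) t := by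
  rw [← hasDerivWithinAt_Ioi_iff_Ici, hasDerivWithinAt_iff_tendsto_slope' (by simp)]
  have hsub : Tendsto (fun s => s - t) (𝓝[>] t) (𝓝[>] 0) := by
    refine tendsto_nhdsWithin_iff.2 ⟨?_, ?_⟩
    · have : Tendsto (fun s => s - t) (𝓝 t) (𝓝 (t - t)) := tendsto_id.sub_const t
      rw [sub_self] at this
      exact this.mono_left nhdsWithin_le_nhds
    · filter_upwards [self_mem_nhdsWithin] with s hs
      exact sub_pos.2 (Set.mem_Ioi.1 hs)
  refine (((S t).continuous.tendsto w).comp (((hS x w).1 h).comp hsub)).congr' ?_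
  filter_upwards [self_mem_nhdsWithin] with s hs
  have h1 : S s x = S t (S (s - t) x) := by
    rw [← ContinuousLinearMap.comp_apply, ← S.map_add' t (s - t) ht (sub_pos.2 (Set.mem_Ioi.1 hs)).le,
      add_sub_cancel]
  simp only [Function.comp_apply, slope_def_module, h1, map_smul, map_sub]
  rw [← RCLike.ofReal_smul_eq_real_smul (𝕜 := 𝕜) (s - t)⁻¹]
  simp

end Normed

section Inner

variable [InnerProductSpace 𝕜 X]

/-- Conservation of energy. Right derivatives suffice, and they are all that the definition of the
generator yields directly. -/
theorem norm_eq_of_hasDerivWithinAt_skew [NormedSpace ℝ X] {u u' : ℝ → X} {T : ℝ} (hT : 0 ≤ T)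
    (hc : ContinuousOn u (Set.Icc 0 T))
    (hd : ∀ t ∈ Set.Ico 0 T, HasDerivWithinAt u (u' t) (Set.Ici t) t)
    (hs : ∀ t ∈ Set.Ico 0 T, inner 𝕜 (u t) (u' t) + inner 𝕜 (u' t) (u t) = 0) :
    ‖u T‖ = ‖u 0‖ := by
  have h := constant_of_has_deriv_right_zero (f := fun t => inner 𝕜 (u t) (u t)) (hc.inner hc)
    (fun t ht => by simpa only [hs t ht] using (hd t ht).inner 𝕜 (hd t ht)) T ⟨hT, le_rfl⟩
  simp only [inner_self_eq_norm_sq_to_K] at h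
  have h2 : ‖u T‖ ^ 2 = ‖u 0‖ ^ 2 := by exact_mod_cast h
  exact (sq_eq_sq₀ (norm_nonneg _) (norm_nonneg _)).1 h2

variable [CompleteSpace X] {S R : C0Semigroup 𝕜 X} {A : X →ₗ.[𝕜] X}

/-- This is the maximality half of skew-adjointness, `D(A*) ⊆ D(A)`: a weak identity tested on the
domain already puts `x` in the domain. -/
theorem _root_.IsSkewAdjointOp.mem_graph (hA : IsSkewAdjointOp A) {x w : X}
    (h : ∀ u : A.domain, inner 𝕜 w (u : X) = inner 𝕜 x (A u)) : (x, -w) ∈ A.graph := by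
  have hx' : x ∈ A.adjoint.domain := LinearPMap.mem_adjoint_domain_of_exists x ⟨w, h⟩
  have hx : x ∈ A.domain := hA.2.1 ▸ hx'
  have hw : A.adjoint ⟨x, hx'⟩ = w := LinearPMap.adjoint_apply_eq hA.1 _ h
  rw [LinearPMap.mem_graph_iff]
  exact ⟨⟨x, hx⟩, rfl, by rw [eq_neg_iff_add_eq_zero, ← hA.2.2 x hx hx', hw]⟩

theorem _root_.IsSkewAdjointOp.inner_add_inner (hA : IsSkewAdjointOp A) {x w x' w' : X}
    (h : (x, w) ∈ A.graph) (h' : (x', w') ∈ A.graph) :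
    inner 𝕜 x w' + inner 𝕜 w x' = 0 := by
  rw [LinearPMap.mem_graph_iff] at h h'
  obtain ⟨⟨x, hx⟩, rfl, rfl⟩ := h
  obtain ⟨y, rfl, rfl⟩ := h'
  have hx' : x ∈ A.adjoint.domain := hA.2.1.symm ▸ hx
  have h1 := LinearPMap.adjoint_isFormalAdjoint hA.1 ⟨x, hx'⟩ y
  simp only at h1 ⊢
  rw [← h1, ← inner_add_left, add_comm, hA.2.2 x hx hx', inner_zero_left]

theorem _root_.IsSkewAdjointOp.neg (hA : IsSkewAdjointOp A) : IsSkewAdjointOp (-A) := by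
  have key : ∀ x w : X, (∀ u : A.domain, inner 𝕜 w (u : X) = inner 𝕜 x ((-A) u)) ↔
      (∀ u : A.domain, inner 𝕜 (-w) (u : X) = inner 𝕜 x (A u)) := fun x w =>
    forall_congr' fun u => by
      rw [LinearPMap.neg_apply, inner_neg_right, inner_neg_left, neg_eq_iff_eq_neg]
  have hd : Dense ((-A).domain : Set X) := hA.1
  have hmem : ∀ x, x ∈ (-A).adjoint.domain → x ∈ A.domain := fun x hx => by
    have h1 := (key x _).1 (fun u => LinearPMap.adjoint_isFormalAdjoint hd ⟨x, hx⟩ u)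
    obtain ⟨y, hy, -⟩ := (LinearPMap.mem_graph_iff _).1 (hA.mem_graph h1)
    have hy' : (y : X) = x := hy
    exact hy' ▸ y.2
  have hadj : ∀ x (hx : x ∈ A.domain) (u : A.domain),
      inner 𝕜 (A ⟨x, hx⟩) (u : X) = inner 𝕜 x ((-A) u) := fun x hx u => by
    have := hA.inner_add_inner (A.mem_graph ⟨x, hx⟩) (A.mem_graph u)
    rw [LinearPMap.neg_apply, inner_neg_right, eq_neg_iff_add_eq_zero, add_comm]
    exact this
  refine ⟨hd, ?_, ?_⟩
  · ext x
    exact ⟨hmem x, fun hx => LinearPMap.mem_adjoint_domain_of_exists x ⟨_, hadj x hx⟩⟩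
  · intro x hx hx'
    rw [LinearPMap.adjoint_apply_eq hd ⟨x, hx'⟩ (hadj x hx)]
    simp [LinearPMap.neg_apply]

theorem _root_.IsSkewAdjointOp.dense_graph (hA : IsSkewAdjointOp A) :
    Dense {x : X | ∃ w, (x, w) ∈ A.graph} :=
  hA.1.mono fun x hx => ⟨_, A.mem_graph ⟨x, hx⟩⟩

theorem HasGenerator.norm_map (hS : S.HasGenerator A) (hA : IsSkewAdjointOp A) {t : ℝ}
    (ht : 0 ≤ t) (x : X) : ‖S t x‖ = ‖x‖ := by
  let : NormedSpace ℝ X := NormedSpace.restrictScalars ℝ 𝕜 X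
  induction x using hA.dense_graph.induction with
  | mem x hx =>
    obtain ⟨w, hw⟩ := hx
    have h0 : S 0 x = x := by rw [S.map_zero']; rfl
    conv_rhs => rw [← h0]
    refine norm_eq_of_hasDerivWithinAt_skew (𝕜 := 𝕜) (u := fun s => S s x)
      (u' := fun s => S s w) ht ((S.continuousOn' x).mono fun s hs => hs.1)
      (fun s hs => hS.hasDerivWithinAt hw hs.1)
      (fun s hs => hA.inner_add_inner (hS.apply_mem_graph hw hs.1) (hS.apply_mem_graph hw hs.1))
  | isClosed => exact isClosed_eq (S t).continuous.norm continuous_norm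

/-- The difference of two orbits starting in the domain obeys the same skew equation and starts at
zero, so its norm stays zero; density does the rest. -/
theorem HasGenerator.eq_of_isSkewAdjointOp (hS : S.HasGenerator A) (hR : R.HasGenerator A)
    (hA : IsSkewAdjointOp A) {t : ℝ} (ht : 0 ≤ t) (x : X) : S t x = R t x := by
  let : NormedSpace ℝ X := NormedSpace.restrictScalars ℝ 𝕜 X
  induction x using hA.dense_graph.induction with
  | mem x hx =>
    obtain ⟨w, hw⟩ := hx
    have h := norm_eq_of_hasDerivWithinAt_skew (𝕜 := 𝕜) (u := fun s => S s x - R s x)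
      (u' := fun s => S s w - R s w) ht
      (((S.continuousOn' x).sub (R.continuousOn' x)).mono fun s hs => hs.1)
      (fun s hs => (hS.hasDerivWithinAt hw hs.1).sub (hR.hasDerivWithinAt hw hs.1))
      (fun s hs => by
        have hm := A.graph.sub_mem (hS.apply_mem_graph hw hs.1) (hR.apply_mem_graph hw hs.1)
        exact hA.inner_add_inner hm hm)
    have h0 : S 0 x - R 0 x = 0 := by rw [S.map_zero', R.map_zero', sub_self]
    rwa [h0, norm_zero, norm_eq_zero, sub_eq_zero] at h
  | isClosed => exact isClosed_eq (S t).continuous (R t).continuous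

/-- The adjoint semigroup of a strongly continuous semigroup of isometries. -/
noncomputable def adjoint (S : C0Semigroup 𝕜 X) (hS : ∀ t, 0 ≤ t → ∀ x, ‖S t x‖ = ‖x‖) :
    C0Semigroup 𝕜 X where
  toFun t := ContinuousLinearMap.adjoint (S t)
  map_zero' := by rw [S.map_zero']; exact ContinuousLinearMap.adjoint_id
  map_add' s t hs ht := by
    rw [add_comm, S.map_add' t s ht hs, ContinuousLinearMap.adjoint_comp]
  continuousOn' x := by
    have hle : ∀ t, 0 ≤ t → ∀ v, ‖ContinuousLinearMap.adjoint (S t) v‖ ≤ ‖v‖ := fun t ht v => by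
      refine (ContinuousLinearMap.le_opNorm _ v).trans ?_
      rw [LinearIsometryEquiv.norm_map]
      exact mul_le_of_le_one_left (norm_nonneg _)
        (ContinuousLinearMap.opNorm_le_bound _ zero_le_one fun w => by rw [hS t ht, one_mul])
    -- Strong continuity does not pass to adjoints by itself. Here the expanded square, the
    -- contraction bound and `⟪S* x, x⟫ = ⟪x, S x⟫` control `S* x - x` by `S x - x`.
    have hsq : ∀ r, 0 ≤ r → ‖ContinuousLinearMap.adjoint (S r) x - x‖ ^ 2 ≤
        2 * ‖x‖ * ‖S r x - x‖ := fun r hr => by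
      have h1 := norm_sub_sq (𝕜 := 𝕜) (ContinuousLinearMap.adjoint (S r) x) x
      have h2 : RCLike.re (inner 𝕜 (ContinuousLinearMap.adjoint (S r) x) x) =
          ‖x‖ ^ 2 + RCLike.re (inner 𝕜 x (S r x - x)) := by
        rw [ContinuousLinearMap.adjoint_inner_left, inner_sub_right, map_sub,
          inner_self_eq_norm_sq]
        ring
      have h3 : -(‖x‖ * ‖S r x - x‖) ≤ RCLike.re (inner 𝕜 x (S r x - x)) :=
        neg_le_of_abs_le ((RCLike.abs_re_le_norm _).trans (norm_inner_le_norm _ _))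
      have h4 := hle r hr x
      have h5 : ‖ContinuousLinearMap.adjoint (S r) x‖ ^ 2 ≤ ‖x‖ ^ 2 := by gcongr
      rw [h2] at h1
      linarith
    have hinc : ∀ s t, 0 ≤ s → 0 ≤ t →
        ‖ContinuousLinearMap.adjoint (S t) x - ContinuousLinearMap.adjoint (S s) x‖ ≤
          ‖ContinuousLinearMap.adjoint (S |t - s|) x - x‖ := by
      have aux : ∀ s t, 0 ≤ s → s ≤ t →
          ‖ContinuousLinearMap.adjoint (S t) x - ContinuousLinearMap.adjoint (S s) x‖ ≤
            ‖ContinuousLinearMap.adjoint (S (t - s)) x - x‖ := fun s t hs hst => by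
        have : S t = (S (t - s)).comp (S s) := by
          rw [← S.map_add' _ _ (sub_nonneg.2 hst) hs, sub_add_cancel]
        rw [this, ContinuousLinearMap.adjoint_comp, ContinuousLinearMap.comp_apply, ← map_sub]
        exact hle s hs _
      intro s t hs ht
      rcases le_total s t with h | h
      · rw [abs_of_nonneg (sub_nonneg.2 h)]
        exact aux s t hs h
      · rw [abs_sub_comm, abs_of_nonneg (sub_nonneg.2 h), norm_sub_rev]
        exact aux t s ht h
    have hlim : Tendsto (fun r => ‖ContinuousLinearMap.adjoint (S r) x - x‖) (𝓝[≥] 0) (𝓝 0) := by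
      have h1 : Tendsto (fun r => S r x - x) (𝓝[≥] 0) (𝓝 0) := by
        have := (S.continuousOn' x 0 Set.self_mem_Ici).tendsto.sub_const x
        rwa [S.map_zero', ContinuousLinearMap.id_apply, sub_self] at this
      have h2 : Tendsto (fun r => 2 * ‖x‖ * ‖S r x - x‖) (𝓝[≥] 0) (𝓝 0) := by
        simpa using h1.norm.const_mul (2 * ‖x‖)
      have h3 : Tendsto (fun r => ‖ContinuousLinearMap.adjoint (S r) x - x‖ ^ 2) (𝓝[≥] 0)
          (𝓝 0) := by
        refine tendsto_of_tendsto_of_tendsto_of_le_of_le' tendsto_const_nhds h2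
          (Eventually.of_forall fun _ => sq_nonneg _) ?_
        filter_upwards [self_mem_nhdsWithin] with r hr using hsq r hr
      simpa using h3.sqrt
    intro s hs
    rw [ContinuousWithinAt, tendsto_iff_norm_sub_tendsto_zero]
    have habs : Tendsto (fun t => |t - s|) (𝓝[Set.Ici 0] s)
        (𝓝[≥] 0) := by
      refine tendsto_nhdsWithin_iff.2 ⟨?_, Eventually.of_forall fun t => Set.mem_Ici.2 (abs_nonneg _)⟩
      have : Tendsto (fun t => |t - s|) (𝓝 s) (𝓝 |s - s|) := (tendsto_id.sub_const s).abs
      rw [sub_self, abs_zero] at this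
      exact this.mono_left nhdsWithin_le_nhds
    refine tendsto_of_tendsto_of_tendsto_of_le_of_le' tendsto_const_nhds (hlim.comp habs)
      (Eventually.of_forall fun _ => norm_nonneg _) ?_
    filter_upwards [self_mem_nhdsWithin] with t ht using hinc s t hs ht

/-- As `S* S = 1`, the quotient of `S*` is `S*` applied to minus the quotient of `S`, which gives
one inclusion of graphs. Conversely, pairing a limit of quotients with the domain gives the weak
identity, and maximality applies. -/
theorem HasGenerator.adjoint (hS : S.HasGenerator A) (hA : IsSkewAdjointOp A) :
    (S.adjoint fun _ ht x => hS.norm_map hA ht x).HasGenerator (-A) := by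
  set R := S.adjoint fun _ ht x => hS.norm_map hA ht x with hR
  have hRS : ∀ t, R t = ContinuousLinearMap.adjoint (S t) := fun _ => rfl
  intro x w
  constructor
  · intro h
    have hg := LinearPMap.mem_neg_graph_iff.1 h
    have h1 : Tendsto (fun t : ℝ => -((t : 𝕜)⁻¹ • (S t x - x))) (𝓝[>] 0) (𝓝 w) := by
      simpa using ((hS x (-w)).1 hg).neg
    have h2 : Tendsto (fun t : ℝ => R t w) (𝓝[>] 0) (𝓝 w) := by
      have := (R.continuousOn' w 0 Set.self_mem_Ici).tendsto
      rw [R.map_zero', ContinuousLinearMap.id_apply] at this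
      exact this.mono_left (nhdsWithin_mono _ Set.Ioi_subset_Ici_self)
    have h3 : Tendsto (fun t : ℝ => R t (-((t : 𝕜)⁻¹ • (S t x - x)) - w)) (𝓝[>] 0) (𝓝 0) := by
      rw [tendsto_zero_iff_norm_tendsto_zero]
      have h4 := (tendsto_iff_norm_sub_tendsto_zero.1 h1)
      refine tendsto_of_tendsto_of_tendsto_of_le_of_le' tendsto_const_nhds h4
        (Eventually.of_forall fun _ => norm_nonneg _) ?_
      filter_upwards [self_mem_nhdsWithin] with t ht
      refine (ContinuousLinearMap.le_opNorm _ _).trans ?_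
      rw [hRS, LinearIsometryEquiv.norm_map]
      exact mul_le_of_le_one_left (norm_nonneg _) (ContinuousLinearMap.opNorm_le_bound _
        zero_le_one fun v => by rw [hS.norm_map hA (le_of_lt ht), one_mul])
    have h5 := h3.add h2
    rw [zero_add] at h5
    refine h5.congr' ?_
    filter_upwards [self_mem_nhdsWithin] with t ht
    have hinv : R t (S t x) = x := by
      have := (ContinuousLinearMap.norm_map_iff_adjoint_comp_self (S t)).1
        fun v => hS.norm_map hA (le_of_lt ht) v
      exact DFunLike.congr_fun this x
    simp only [map_sub, map_neg, map_smul, hinv, smul_sub]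
    abel
  · intro h
    refine LinearPMap.mem_neg_graph_iff.2 (hA.mem_graph fun u => ?_)
    have h1 : Tendsto (fun t : ℝ => inner 𝕜 ((t : 𝕜)⁻¹ • (R t x - x)) (u : X)) (𝓝[>] 0)
        (𝓝 (inner 𝕜 w (u : X))) := h.inner tendsto_const_nhds
    have h2 : Tendsto (fun t : ℝ => inner 𝕜 x ((t : 𝕜)⁻¹ • (S t u - (u : X)))) (𝓝[>] 0)
        (𝓝 (inner 𝕜 x (A u))) := tendsto_const_nhds.inner ((hS _ _).1 (A.mem_graph u))
    refine tendsto_nhds_unique h1 (h2.congr fun t => ?_)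
    rw [inner_smul_left, inner_smul_right, inner_sub_left, inner_sub_right, hRS,
      ContinuousLinearMap.adjoint_inner_left, map_inv₀, RCLike.conj_ofReal]

/-- By uniqueness `R` is the adjoint of `S`. It is itself isometric, being generated by a
skew-adjoint operator, so `R* R = 1` reads `S R = 1`. -/
theorem HasGenerator.apply_neg_apply (hS : S.HasGenerator A) (hR : R.HasGenerator (-A))
    (hA : IsSkewAdjointOp A) {t : ℝ} (ht : 0 ≤ t) (x : X) : S t (R t x) = x := by
  have h1 : ContinuousLinearMap.adjoint (S t) = R t :=
    ContinuousLinearMap.ext fun v => (hS.adjoint hA).eq_of_isSkewAdjointOp hR hA.neg ht v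
  have h2 := (ContinuousLinearMap.norm_map_iff_adjoint_comp_self (R t)).1
    fun v => hR.norm_map hA.neg ht v
  rw [← h1, ContinuousLinearMap.adjoint_adjoint, h1] at h2
  exact DFunLike.congr_fun h2 x

end Inner

end C0Semigroup

end SkewAdjoint

/-! ### Unitary groups. -/

section UnitaryGroup

/-- A strongly continuous group of linear isometries of `X`. -/
structure UnitaryGroup (𝕜 X : Type*) [RCLike 𝕜] [NormedAddCommGroup X] [NormedSpace 𝕜 X] where
  toFun : ℝ → X →L[𝕜] X
  map_zero' : toFun 0 = ContinuousLinearMap.id 𝕜 X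
  map_add' : ∀ s t : ℝ, toFun (s + t) = (toFun s).comp (toFun t)
  norm_map' : ∀ (t : ℝ) (x : X), ‖toFun t x‖ = ‖x‖
  continuous' : ∀ x : X, Continuous fun t => toFun t x

instance UnitaryGroup.instCoeFun (𝕜 X : Type*) [RCLike 𝕜] [NormedAddCommGroup X]
    [NormedSpace 𝕜 X] : CoeFun (UnitaryGroup 𝕜 X) (fun _ => ℝ → X →L[𝕜] X) :=
  ⟨UnitaryGroup.toFun⟩

variable {𝕜 X : Type*} [RCLike 𝕜] [NormedAddCommGroup X]

namespace UnitaryGroup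

section Normed

variable [NormedSpace 𝕜 X] (U : UnitaryGroup 𝕜 X)

theorem map_zero_apply (x : X) : U 0 x = x := by
  rw [U.map_zero', ContinuousLinearMap.id_apply]

theorem apply_apply (s t : ℝ) (x : X) : U s (U t x) = U (s + t) x := by
  rw [U.map_add', ContinuousLinearMap.comp_apply]

theorem apply_neg_apply (t : ℝ) (x : X) : U t (U (-t) x) = x := by
  rw [U.apply_apply, add_neg_cancel, U.map_zero_apply]

theorem neg_apply_apply (t : ℝ) (x : X) : U (-t) (U t x) = x := by
  rw [U.apply_apply, neg_add_cancel, U.map_zero_apply]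

/-- Isometry upgrades strong continuity to joint continuity, which later supplies measurability of
`s ↦ U s (g s)`. -/
theorem continuous_uncurry : Continuous fun p : ℝ × X => U p.1 p.2 := by
  refine continuous_iff_continuousAt.2 fun p => ?_
  rw [ContinuousAt, tendsto_iff_norm_sub_tendsto_zero]
  have h1 : Tendsto (fun q : ℝ × X => ‖q.2 - p.2‖ + ‖U q.1 p.2 - U p.1 p.2‖) (𝓝 p) (𝓝 0) := by
    have : Continuous fun q : ℝ × X => ‖q.2 - p.2‖ + ‖U q.1 p.2 - U p.1 p.2‖ :=
      (continuous_snd.sub continuous_const).norm.add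
        (((U.continuous' p.2).comp continuous_fst).sub continuous_const).norm
    simpa using this.tendsto p
  refine squeeze_zero (fun _ => norm_nonneg _) (fun q => ?_) h1
  rw [← U.norm_map' q.1 (q.2 - p.2), map_sub]
  exact norm_sub_le_norm_sub_add_norm_sub _ _ _

theorem continuous_apply {α : Type*} [TopologicalSpace α] {r : α → ℝ} {g : α → X}
    (hr : Continuous r) (hg : Continuous g) : Continuous fun a => U (r a) (g a) :=
  U.continuous_uncurry.comp (hr.prodMk hg)

theorem continuousOn_apply {α : Type*} [TopologicalSpace α] {r : α → ℝ} {g : α → X} {s : Set α}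
    (hr : Continuous r) (hg : ContinuousOn g s) : ContinuousOn (fun a => U (r a) (g a)) s :=
  U.continuous_uncurry.comp_continuousOn (hr.continuousOn.prodMk hg)

/-- The time reversal `t ↦ U (-t)`. -/
def reverse : UnitaryGroup 𝕜 X where
  toFun t := U (-t)
  map_zero' := by rw [neg_zero, U.map_zero']
  map_add' s t := by rw [neg_add, U.map_add']
  norm_map' t x := U.norm_map' (-t) x
  continuous' x := (U.continuous' x).comp continuous_neg

theorem reverse_apply (t : ℝ) : U.reverse t = U (-t) := rfl

end Normed

theorem inner_apply_left [InnerProductSpace 𝕜 X] (U : UnitaryGroup 𝕜 X) (t : ℝ) (x y : X) :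
    inner 𝕜 (U t x) y = inner 𝕜 x (U (-t) y) := by
  let V : X →ₗᵢ[𝕜] X := ⟨(U t : X →ₗ[𝕜] X), U.norm_map' t⟩
  have := V.inner_map_map x (U (-t) y)
  rw [← this]
  change _ = inner 𝕜 (U t x) (U t (U (-t) y))
  rw [U.apply_neg_apply]

end UnitaryGroup

theorem C0Semigroup.exists_unitaryGroup [NormedSpace 𝕜 X] (S R : C0Semigroup 𝕜 X)
    (hSR : ∀ t, 0 ≤ t → ∀ x, S t (R t x) = x) (hRS : ∀ t, 0 ≤ t → ∀ x, R t (S t x) = x)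
    (hS : ∀ t, 0 ≤ t → ∀ x, ‖S t x‖ = ‖x‖) :
    ∃ U : UnitaryGroup 𝕜 X, (∀ t, 0 ≤ t → U t = S t) ∧ ∀ t, 0 ≤ t → U (-t) = R t := by
  classical
  let V : ℝ → X →L[𝕜] X := fun t => if 0 ≤ t then S t else R (-t)
  have hV1 : ∀ t, 0 ≤ t → V t = S t := fun t ht => if_pos ht
  have hV2 : ∀ t, 0 ≤ t → V (-t) = R t := fun t ht => by
    rcases ht.eq_or_lt with rfl | ht'
    · rw [neg_zero, hV1 0 le_rfl, S.map_zero', R.map_zero']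
    · simp only [V, neg_neg]
      exact if_neg (by linarith)
  have hV3 : ∀ t, t ≤ 0 → V t = R (-t) := fun t ht => by
    simpa using hV2 (-t) (neg_nonneg.2 ht)
  have Sadd : ∀ s t x, 0 ≤ s → 0 ≤ t → S s (S t x) = S (s + t) x := fun s t x hs ht => by
    rw [S.map_add' s t hs ht, ContinuousLinearMap.comp_apply]
  have Radd : ∀ s t x, 0 ≤ s → 0 ≤ t → R s (R t x) = R (s + t) x := fun s t x hs ht => by
    rw [R.map_add' s t hs ht, ContinuousLinearMap.comp_apply]
  have hR : ∀ t, 0 ≤ t → ∀ x, ‖R t x‖ = ‖x‖ := fun t ht x => by rw [← hS t ht, hSR t ht]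
  have hadd : ∀ s t x, V s (V t x) = V (s + t) x := by
    intro s t x
    rcases le_total 0 s with hs | hs <;> rcases le_total 0 t with ht | ht
    · rw [hV1 s hs, hV1 t ht, hV1 _ (add_nonneg hs ht), Sadd s t x hs ht]
    · rw [hV1 s hs, hV3 t ht]
      rcases le_total 0 (s + t) with h | h
      · rw [hV1 _ h]
        conv_lhs => rw [show s = (s + t) + -t by ring, ← Sadd _ _ _ h (by linarith),
          hSR _ (by linarith)]
      · rw [hV3 _ h]
        conv_lhs => rw [show -t = s + -(s + t) by ring, ← Radd _ _ _ hs (by linarith),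
          hSR _ hs]
    · rw [hV3 s hs, hV1 t ht]
      rcases le_total 0 (s + t) with h | h
      · rw [hV1 _ h]
        conv_lhs => rw [show t = -s + (s + t) by ring, ← Sadd _ _ _ (by linarith) h,
          hRS _ (by linarith)]
      · rw [hV3 _ h]
        conv_lhs => rw [show -s = -(s + t) + t by ring, ← Radd _ _ _ (by linarith) ht,
          hRS _ ht]
    · rw [hV3 s hs, hV3 t ht, hV3 _ (add_nonpos hs ht), Radd _ _ _ (by linarith) (by linarith),
        neg_add]
  refine ⟨⟨V, by rw [hV1 0 le_rfl, S.map_zero'], fun s t => ContinuousLinearMap.ext fun x =>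
    (hadd s t x).symm, fun t x => ?_, fun x => ?_⟩, hV1, hV2⟩
  · rcases le_total 0 t with ht | ht
    · rw [hV1 t ht, hS t ht]
    · rw [hV3 t ht, hR _ (by linarith)]
  · rw [← continuousOn_univ, ← Set.Iic_union_Ici (a := (0 : ℝ))]
    refine ContinuousOn.union_of_isClosed ?_ ?_ isClosed_Iic isClosed_Ici
    · have h := (R.continuousOn' x).comp (s := Set.Iic 0) continuous_neg.continuousOn
        fun t ht => neg_nonneg.2 (Set.mem_Iic.1 ht)
      exact h.congr fun t ht => by rw [hV3 t ht]; rfl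
    · exact (S.continuousOn' x).congr fun t ht => by rw [hV1 t ht]

end UnitaryGroup

/-! ### Strongly continuous operator families and Volterra equations. -/

section OperatorFamilies

variable {𝕜 X Z : Type*} [RCLike 𝕜] [NormedAddCommGroup X] [NormedSpace 𝕜 X]
  [NormedAddCommGroup Z] [NormedSpace 𝕜 Z]

theorem IntervalIntegrable.clm_family_apply {Φ : ℝ → X →L[𝕜] Z} {M a b : ℝ} {g : ℝ → X}
    (hg : IntervalIntegrable g volume a b) (hΦ : Continuous fun p : ℝ × X => Φ p.1 p.2)
    (hM : ∀ s x, ‖Φ s x‖ ≤ M * ‖x‖) :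
    IntervalIntegrable (fun s => Φ s (g s)) volume a b := by
  rw [intervalIntegrable_iff] at hg ⊢
  refine Integrable.mono' (hg.norm.const_mul M) ?_ (Eventually.of_forall fun s => hM s _)
  exact hΦ.comp_aestronglyMeasurable
    (continuous_id.aestronglyMeasurable.prodMk hg.aestronglyMeasurable)

variable [NormedSpace ℝ X] [CompleteSpace X]

/-- Picard iteration in an exponentially weighted norm: for `v t = exp (-(L + 1) t) w t` the map
contracts with factor `L / (L + 1)` on all of `[0, T]` at once. -/
theorem exists_volterra_solution {K : ℝ → X →L[𝕜] X}
    (hK : Continuous fun p : ℝ × X => K p.1 p.2) {L T : ℝ} (hL : 0 ≤ L)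
    (hKL : ∀ s x, ‖K s x‖ ≤ L * ‖x‖) (hT : 0 ≤ T) {a : ℝ → X} (ha : ContinuousOn a (Set.Icc 0 T)) :
    ∃ w : ℝ → X, ContinuousOn w (Set.Icc 0 T) ∧
      ∀ t ∈ Set.Icc 0 T, w t = a t + ∫ s in (0 : ℝ)..t, K s (w s) := by
  have hlam : 0 < L + 1 := by linarith
  let G : C(Set.Icc 0 T, X) → ℝ → X :=
    fun v s => K s (Real.exp ((L + 1) * s) • v (Set.projIcc 0 T hT s))
  have hG : ∀ v, Continuous (G v) := fun v => by
    have h1 : Continuous fun s => Real.exp ((L + 1) * s) • v (Set.projIcc 0 T hT s) :=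
      (Real.continuous_exp.comp (continuous_const.mul continuous_id)).smul
        (v.continuous.comp continuous_projIcc)
    exact hK.comp (continuous_id.prodMk h1)
  have hprim : ∀ v, Continuous fun t => ∫ s in (0 : ℝ)..t, G v s := fun v =>
    intervalIntegral.continuous_primitive (fun _ _ => (hG v).intervalIntegrable _ _) 0
  let P : C(Set.Icc 0 T, X) → C(Set.Icc 0 T, X) := fun v =>
    ⟨fun t => Real.exp (-((L + 1) * t)) • (a t + ∫ s in (0 : ℝ)..t, G v s), by
      refine Continuous.smul (by fun_prop) (Continuous.add ?_ ?_)
      · exact continuousOn_iff_continuous_domRestrict.1 ha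
      · exact (hprim v).comp continuous_subtype_val⟩
  have hP : ContractingWith (L / (L + 1)).toNNReal P := by
    refine ⟨?_, LipschitzWith.of_dist_le_mul fun v v' => ?_⟩
    · rw [Real.toNNReal_lt_one, div_lt_one hlam]
      linarith
    rw [Real.coe_toNNReal _ (by positivity), ContinuousMap.dist_le (by positivity)]
    intro t
    have hdiff : P v t - P v' t = Real.exp (-((L + 1) * t)) •
        ∫ s in (0 : ℝ)..t, (G v s - G v' s) := by
      rw [intervalIntegral.integral_sub ((hG v).intervalIntegrable _ _)
        ((hG v').intervalIntegrable _ _)]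
      simp only [P, ContinuousMap.coe_mk, ← smul_sub]
      congr 1
      abel
    have hint : ‖∫ s in (0 : ℝ)..t, (G v s - G v' s)‖ ≤
        ∫ s in (0 : ℝ)..t, L * dist v v' * Real.exp ((L + 1) * s) := by
      refine intervalIntegral.norm_integral_le_of_norm_le t.2.1
        (Eventually.of_forall fun s _ => ?_) (Continuous.intervalIntegrable (by fun_prop) _ _)
      simp only [G]
      rw [← map_sub, ← smul_sub]
      refine (hKL s _).trans ?_
      rw [norm_smul, Real.norm_of_nonneg (Real.exp_pos _).le, ← dist_eq_norm]
      have := ContinuousMap.dist_apply_le_dist (f := v) (g := v') (Set.projIcc 0 T hT s)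
      calc L * (Real.exp ((L + 1) * s) * _) ≤ L * (Real.exp ((L + 1) * s) * dist v v') := by
            gcongr
        _ = _ := by ring
    have hexp : ∫ s in (0 : ℝ)..t, L * dist v v' * Real.exp ((L + 1) * s) =
        L * dist v v' * ((L + 1)⁻¹ * (Real.exp ((L + 1) * t) - 1)) := by
      rw [intervalIntegral.integral_const_mul, intervalIntegral.integral_comp_mul_left _ hlam.ne',
        integral_exp, mul_zero, Real.exp_zero, smul_eq_mul]
    rw [dist_eq_norm, hdiff, norm_smul, Real.norm_of_nonneg (Real.exp_pos _).le]
    rw [hexp] at hint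
    refine (mul_le_mul_of_nonneg_left hint (Real.exp_pos _).le).trans ?_
    have he : Real.exp (-((L + 1) * t)) * Real.exp ((L + 1) * t) = 1 := by
      rw [← Real.exp_add, neg_add_cancel, Real.exp_zero]
    calc Real.exp (-((L + 1) * t)) * (L * dist v v' * ((L + 1)⁻¹ * (Real.exp ((L + 1) * t) - 1)))
        = L / (L + 1) * dist v v' * (Real.exp (-((L + 1) * t)) * Real.exp ((L + 1) * t) -
            Real.exp (-((L + 1) * t))) := by ring
      _ ≤ L / (L + 1) * dist v v' * 1 := by
          rw [he]
          gcongr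
          linarith [Real.exp_pos (-((L + 1) * t))]
      _ = _ := mul_one _
  have hv : P (ContractingWith.fixedPoint P hP) = ContractingWith.fixedPoint P hP :=
    hP.fixedPoint_isFixedPt
  set v := ContractingWith.fixedPoint P hP
  refine ⟨fun s => Real.exp ((L + 1) * s) • v (Set.projIcc 0 T hT s), ?_, fun t ht => ?_⟩
  · exact Continuous.continuousOn (Continuous.smul (by fun_prop)
      (v.continuous.comp continuous_projIcc))
  · have h1 : v ⟨t, ht⟩ = Real.exp (-((L + 1) * t)) • (a t + ∫ s in (0 : ℝ)..t, G v s) := by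
      conv_lhs => rw [← hv]
      rfl
    simp only
    rw [Set.projIcc_of_mem hT ht, h1, smul_smul, ← Real.exp_add, add_neg_cancel, Real.exp_zero,
      one_smul]

end OperatorFamilies

/-! ### A scalar recursion. -/

section Sequences

/-- Subtracting `D ∑ κ²` from `a` leaves a decreasing sequence bounded below, so `a` converges. A
limit `l > 0` would cost at least `c κ l / 2` per step eventually, and these costs have infinite
sum. -/
theorem tendsto_zero_of_le_one_sub_mul_add {a κ : ℕ → ℝ} {c D : ℝ} (ha : ∀ n, 0 ≤ a n)
    (hκ : ∀ n, 0 ≤ κ n) (hc : 0 < c) (hD : 0 ≤ D)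
    (hκ_sum : Tendsto (fun n => ∑ j ∈ Finset.range n, κ j) atTop atTop)
    (hκ_sq : Summable fun n => κ n ^ 2)
    (h : ∀ᶠ n in atTop, a (n + 1) ≤ (1 - c * κ n) * a n + D * κ n ^ 2) :
    Tendsto a atTop (𝓝 0) := by
  obtain ⟨N, hN⟩ := eventually_atTop.1 h
  let s : ℕ → ℝ := fun n => ∑ j ∈ Finset.range n, κ j
  let q : ℕ → ℝ := fun n => ∑ j ∈ Finset.range n, κ j ^ 2
  have hq : ∀ n, q n ≤ ∑' j, κ j ^ 2 := fun n => hκ_sq.sum_le_tsum _ fun _ _ => sq_nonneg _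
  let b : ℕ → ℝ := fun n => a (n + N) - D * q (n + N)
  have hb_step : ∀ n, b (n + 1) + c * κ (n + N) * a (n + N) ≤ b n := fun n => by
    have h1 := hN (n + N) (Nat.le_add_left _ _)
    have h2 : q (n + 1 + N) = q (n + N) + κ (n + N) ^ 2 := by
      rw [add_right_comm]
      exact Finset.sum_range_succ _ _
    simp only [b, h2]
    rw [add_right_comm n 1 N]
    linarith
  have hb_anti : Antitone b := antitone_nat_of_succ_le fun n => by
    have := hb_step n
    have : 0 ≤ c * κ (n + N) * a (n + N) := mul_nonneg (mul_nonneg hc.le (hκ _)) (ha _)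
    linarith
  have hb_lower : ∀ n, -(D * ∑' j, κ j ^ 2) ≤ b n := fun n => by
    have := mul_le_mul_of_nonneg_left (hq (n + N)) hD
    have := ha (n + N)
    simp only [b]
    linarith
  have hb_lim := tendsto_atTop_ciInf hb_anti
    ⟨-(D * ∑' j, κ j ^ 2), Set.forall_mem_range.2 hb_lower⟩
  have hq_lim : Tendsto (fun n => q (n + N)) atTop (𝓝 (∑' j, κ j ^ 2)) :=
    (tendsto_add_atTop_iff_nat N).2 hκ_sq.hasSum.tendsto_sum_nat
  obtain ⟨l, hl⟩ : ∃ l, Tendsto (fun n => a (n + N)) atTop (𝓝 l) :=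
    ⟨_, (hb_lim.add (hq_lim.const_mul D)).congr fun n => by simp only [b]; ring⟩
  have hl0 : 0 ≤ l := ge_of_tendsto' hl fun n => ha _
  rcases hl0.eq_or_lt with rfl | hlpos
  · exact (tendsto_add_atTop_iff_nat N).1 hl
  exfalso
  obtain ⟨M, hM⟩ := eventually_atTop.1 (hl.eventually (lt_mem_nhds (half_lt_self hlpos)))
  have hsum : ∀ n, b (M + n) + c * (l / 2) * (s (M + n + N) - s (M + N)) ≤ b M := by
    intro n
    induction n with
    | zero => simp
    | succ n ih =>
      have h1 := hb_step (M + n)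
      have h2 : s (M + (n + 1) + N) = s (M + n + N) + κ (M + n + N) := by
        rw [← add_assoc, add_right_comm]
        exact Finset.sum_range_succ _ _
      have h3 : c * κ (M + n + N) * (l / 2) ≤ c * κ (M + n + N) * a (M + n + N) :=
        mul_le_mul_of_nonneg_left (hM (M + n) (Nat.le_add_right _ _)).le
          (mul_nonneg hc.le (hκ _))
      rw [h2, ← add_assoc]
      linarith
  have hs : Tendsto (fun n => s (n + (M + N))) atTop atTop :=
    (tendsto_add_atTop_iff_nat (M + N)).2 hκ_sum
  obtain ⟨n, hn⟩ := (hs.eventually_gt_atTop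
    (s (M + N) + (b M + D * ∑' j, κ j ^ 2) / (c * (l / 2)))).exists
  have h1 := hsum n
  have h2 := hb_lower (M + n)
  have hpos : 0 < c * (l / 2) := by positivity
  rw [show n + (M + N) = M + n + N by ring, ← lt_sub_iff_add_lt', div_lt_iff₀ hpos] at hn
  linarith

end Sequences

/-! ### Coercive Gramians and the effect of one sweep. -/

section Coercive

variable {𝕜 X : Type*} [RCLike 𝕜] [NormedAddCommGroup X] [InnerProductSpace 𝕜 X]

/-- Expanding the square gives at most `(1 - δ κ) ‖v‖²`, which is below `(1 - δ κ / 2)² ‖v‖²`; `κ δ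
≤ 1` keeps the factor nonnegative. -/
theorem norm_sub_smul_le_of_coercive {v g : X} {B δ κ : ℝ} (hg : ‖g‖ ≤ B * ‖v‖)
    (hδ : δ * ‖v‖ ^ 2 ≤ RCLike.re (inner 𝕜 g v)) (hκ : 0 ≤ κ) (hκB : κ * B ^ 2 ≤ δ)
    (hκδ : κ * δ ≤ 1) : ‖v - (κ : 𝕜) • g‖ ≤ (1 - δ / 2 * κ) * ‖v‖ := by
  have h1 := norm_sub_sq (𝕜 := 𝕜) v ((κ : 𝕜) • g)
  rw [inner_smul_right, RCLike.re_ofReal_mul, inner_re_symm, norm_smul, RCLike.norm_ofReal,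
    abs_of_nonneg hκ, mul_pow] at h1
  have h2 : ‖g‖ ^ 2 ≤ B ^ 2 * ‖v‖ ^ 2 := by
    rw [← mul_pow]
    gcongr
  have h3 : κ ^ 2 * ‖g‖ ^ 2 ≤ κ * δ * ‖v‖ ^ 2 := by
    calc κ ^ 2 * ‖g‖ ^ 2 ≤ κ ^ 2 * (B ^ 2 * ‖v‖ ^ 2) := by gcongr
      _ = κ * (κ * B ^ 2) * ‖v‖ ^ 2 := by ring
      _ ≤ κ * δ * ‖v‖ ^ 2 := by gcongr
  have h4 := mul_le_mul_of_nonneg_left hδ hκ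
  refine (sq_le_sq₀ (norm_nonneg _) (mul_nonneg (by linarith) (norm_nonneg v))).1 ?_
  have h5 : 0 ≤ (δ / 2 * κ) ^ 2 * ‖v‖ ^ 2 := by positivity
  nlinarith

/-- The bound `1 / 2` absorbs the supremum of the error into itself; `δ / 8` lets the second-order
terms spend only half of the contraction rate `δ / 2`. -/
theorem exists_small_gain {B δ : ℝ} (hδ : 0 < δ) :
    ∃ κ₀ > (0 : ℝ), ∀ κ, 0 ≤ κ → κ ≤ κ₀ → κ * B ≤ 1 / 2 ∧ κ * B ^ 2 ≤ δ / 8 ∧ κ * δ ≤ 1 := by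
  have hlim : ∀ b : ℝ, Tendsto (fun κ : ℝ => κ * b) (𝓝 0) (𝓝 0) := fun b => by
    have : Continuous fun κ : ℝ => κ * b := continuous_id.mul continuous_const
    simpa only [zero_mul] using this.tendsto 0
  have h := ((hlim B).eventually (ge_mem_nhds (show (0 : ℝ) < 1 / 2 by norm_num))).and
    (((hlim (B ^ 2)).eventually (ge_mem_nhds (show (0 : ℝ) < δ / 8 by linarith))).and
    ((hlim δ).eventually (ge_mem_nhds one_pos)))
  obtain ⟨ε, hε, hball⟩ := Metric.eventually_nhds_iff.1 h
  refine ⟨ε / 2, by linarith, fun κ h0 h1 => hball ?_⟩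
  rw [Real.dist_eq, sub_zero, abs_of_nonneg h0]
  linarith

variable [NormedSpace ℝ X]

theorem norm_integral_clm_family_le {K : ℝ → X →L[𝕜] X} {L T : ℝ}
    (hKL : ∀ s x, ‖K s x‖ ≤ L * ‖x‖) (hL : 0 ≤ L) {t : ℝ} (ht : t ∈ Set.Icc 0 T) {u : ℝ → X}
    {M : ℝ} (hM : 0 ≤ M) (hu : ∀ s ∈ Set.Icc 0 T, ‖u s‖ ≤ M) :
    ‖∫ s in (0 : ℝ)..t, K s (u s)‖ ≤ L * T * M := by
  have h := intervalIntegral.norm_integral_le_of_norm_le_const (a := 0) (b := t) (C := L * M)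
    (f := fun s => K s (u s)) fun s hs => by
      rw [Set.uIoc_of_le ht.1] at hs
      exact (hKL _ _).trans (mul_le_mul_of_nonneg_left (hu s ⟨hs.1.le, hs.2.trans ht.2⟩) hL)
  rw [sub_zero, abs_of_nonneg ht.1] at h
  calc _ ≤ L * M * t := h
    _ ≤ L * M * T := mul_le_mul_of_nonneg_left ht.2 (mul_nonneg hL hM)
    _ = _ := by ring

theorem exists_norm_le_of_nudging {K : ℝ → X →L[𝕜] X}
    (hK : Continuous fun p : ℝ × X => K p.1 p.2) {L T δ : ℝ} (hL : 0 ≤ L)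
    (hKL : ∀ s x, ‖K s x‖ ≤ L * ‖x‖) (hT : 0 ≤ T) (hδ : 0 < δ)
    (hco : ∀ x, δ * ‖x‖ ^ 2 ≤ RCLike.re (inner 𝕜 (∫ s in (0 : ℝ)..T, K s x) x))
    {h : ℝ → X} (hh : IntervalIntegrable h volume 0 T) (hh0 : ∫ s in (0 : ℝ)..T, h s = 0) :
    ∃ κ₀ > (0 : ℝ), ∃ D, 0 ≤ D ∧ ∀ κ, 0 ≤ κ → κ ≤ κ₀ → ∀ w : ℝ → X, ContinuousOn w (Set.Icc 0 T) →
      (∀ t ∈ Set.Icc 0 T, w t = w 0 + (κ : 𝕜) • ∫ s in (0 : ℝ)..t, (h s - K s (w s))) →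
      ‖w T‖ ≤ (1 - δ / 4 * κ) * ‖w 0‖ + D * κ ^ 2 := by
  obtain ⟨κ₀, hκ₀, hsmall⟩ := exists_small_gain (B := L * T) hδ
  set B := L * T with hB
  have hB0 : 0 ≤ B := mul_nonneg hL hT
  set R := ∫ s in (0 : ℝ)..T, ‖h s‖ with hR
  have hR0 : 0 ≤ R := intervalIntegral.integral_nonneg hT fun _ _ => norm_nonneg _
  refine ⟨κ₀, hκ₀, 2 * B * R, by positivity, fun κ hκ hκ' w hw hwt => ?_⟩
  obtain ⟨h1, h2, h3⟩ := hsmall κ hκ hκ'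
  have hTmem : T ∈ Set.Icc 0 T := ⟨hT, le_rfl⟩
  obtain ⟨τ, hτ, hmax⟩ := isCompact_Icc.exists_isMaxOn (Set.nonempty_Icc.2 hT) hw.norm
  set M := ‖w τ‖ with hMdef
  have hM0 : 0 ≤ M := norm_nonneg _
  have hM : ∀ s ∈ Set.Icc 0 T, ‖w s‖ ≤ M := fun s hs => hmax hs
  have hKint : ∀ u : ℝ → X, ContinuousOn u (Set.Icc 0 T) → ∀ t ∈ Set.Icc 0 T,
      IntervalIntegrable (fun s => K s (u s)) volume 0 t := fun u hu t ht => by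
    refine ContinuousOn.intervalIntegrable ?_
    rw [Set.uIcc_of_le ht.1]
    exact (hK.comp_continuousOn (continuousOn_id.prodMk hu)).mono
      (Set.Icc_subset_Icc le_rfl ht.2)
  have hhint : ∀ t ∈ Set.Icc 0 T, IntervalIntegrable h volume 0 t := fun t ht =>
    hh.mono_set (by
      rw [Set.uIcc_of_le ht.1, Set.uIcc_of_le hT]
      exact Set.Icc_subset_Icc le_rfl ht.2)
  have hhle : ∀ t ∈ Set.Icc 0 T, ‖∫ s in (0 : ℝ)..t, h s‖ ≤ R := fun t ht =>
    (intervalIntegral.norm_integral_le_integral_norm ht.1).trans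
      (intervalIntegral.integral_mono_interval le_rfl ht.1 ht.2
        (Eventually.of_forall fun _ => norm_nonneg _) hh.norm)
  have hdiff : ∀ t ∈ Set.Icc 0 T, ‖w t - w 0‖ ≤ κ * (R + B * M) := fun t ht => by
    rw [hwt t ht, add_sub_cancel_left, norm_smul, RCLike.norm_ofReal, abs_of_nonneg hκ,
      intervalIntegral.integral_sub (hhint t ht) (hKint w hw t ht)]
    gcongr
    exact (norm_sub_le _ _).trans
      (add_le_add (hhle t ht) (norm_integral_clm_family_le hKL hL ht hM0 hM))
  -- Evaluate at the maximum point `τ` and absorb `κ B M ≤ M / 2`.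
  have hMle : M ≤ 2 * ‖w 0‖ + 2 * κ * R := by
    have h4 : M ≤ ‖w 0‖ + ‖w τ - w 0‖ := by
      simpa using norm_add_le (w 0) (w τ - w 0)
    have h5 := hdiff τ hτ
    have h6 : κ * B * M ≤ 1 / 2 * M := mul_le_mul_of_nonneg_right h1 hM0
    linarith
  -- Freeze `w` at its initial value in the kernel: a Gramian step plus a remainder of order `κ²`,
  -- the forcing having integral zero.
  have hwT : w T = (w 0 - (κ : 𝕜) • ∫ s in (0 : ℝ)..T, K s (w 0)) -
      (κ : 𝕜) • ∫ s in (0 : ℝ)..T, K s (w s - w 0) := by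
    rw [hwt T hTmem, intervalIntegral.integral_sub hh (hKint w hw T hTmem), hh0]
    simp only [map_sub]
    rw [intervalIntegral.integral_sub (hKint w hw T hTmem)
      (hKint (fun _ => w 0) continuousOn_const T hTmem), smul_sub, smul_sub, smul_zero]
    abel
  have h7 : ‖w 0 - (κ : 𝕜) • ∫ s in (0 : ℝ)..T, K s (w 0)‖ ≤ (1 - δ / 2 * κ) * ‖w 0‖ :=
    norm_sub_smul_le_of_coercive (B := B)
      (norm_integral_clm_family_le hKL hL hTmem (norm_nonneg _) fun _ _ => le_rfl)
      (hco _) hκ (by linarith) h3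
  have h8 : ‖(κ : 𝕜) • ∫ s in (0 : ℝ)..T, K s (w s - w 0)‖ ≤ κ * (B * (κ * (R + B * M))) := by
    rw [norm_smul, RCLike.norm_ofReal, abs_of_nonneg hκ]
    gcongr
    exact norm_integral_clm_family_le hKL hL hTmem (by positivity) hdiff
  have h9 : κ * (B * (κ * (R + B * M))) ≤ 2 * B * R * κ ^ 2 + δ / 4 * κ * ‖w 0‖ := by
    calc κ * (B * (κ * (R + B * M)))
        ≤ κ * (B * (κ * (R + B * (2 * ‖w 0‖ + 2 * κ * R)))) := by gcongr
      _ = κ ^ 2 * B * R + 2 * κ ^ 2 * B * R * (κ * B) + 2 * κ * ‖w 0‖ * (κ * B ^ 2) := by ring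
      _ ≤ κ ^ 2 * B * R + 2 * κ ^ 2 * B * R * (1 / 2) + 2 * κ * ‖w 0‖ * (δ / 8) := by gcongr
      _ = _ := by ring
  rw [hwT]
  refine (norm_sub_le _ _).trans ((add_le_add h7 (h8.trans h9)).trans (le_of_eq ?_))
  ring

variable [CompleteSpace X]

/-- A coercive bounded operator is onto: the iteration `x ↦ x - κ (G x - b)` contracts for small
`κ`, and its fixed point solves `G x = b`. -/
theorem exists_integral_clm_family_eq {K : ℝ → X →L[𝕜] X}
    (hK : Continuous fun p : ℝ × X => K p.1 p.2) {L T δ : ℝ} (hL : 0 ≤ L)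
    (hKL : ∀ s x, ‖K s x‖ ≤ L * ‖x‖) (hT : 0 ≤ T) (hδ : 0 < δ)
    (hco : ∀ x, δ * ‖x‖ ^ 2 ≤ RCLike.re (inner 𝕜 (∫ s in (0 : ℝ)..T, K s x) x)) (b : X) :
    ∃ x, ∫ s in (0 : ℝ)..T, K s x = b := by
  obtain ⟨κ, hκ, hsmall⟩ := exists_small_gain (B := L * T) hδ
  obtain ⟨-, h2, h3⟩ := hsmall κ hκ.le le_rfl
  let G : X → X := fun x => ∫ s in (0 : ℝ)..T, K s x
  have hint : ∀ x, IntervalIntegrable (fun s => K s x) volume 0 T := fun x =>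
    (hK.comp (continuous_id.prodMk continuous_const)).intervalIntegrable _ _
  have hGsub : ∀ x x', G x - G x' = G (x - x') := fun x x' => by
    simp only [G, map_sub]
    exact (intervalIntegral.integral_sub (hint x) (hint x')).symm
  let P : X → X := fun x => x - (κ : 𝕜) • (G x - b)
  have hP : ContractingWith (1 - δ / 2 * κ).toNNReal P := by
    refine ⟨?_, LipschitzWith.of_dist_le_mul fun x x' => ?_⟩
    · rw [Real.toNNReal_lt_one]
      have : 0 < δ / 2 * κ := by positivity
      linarith
    rw [Real.coe_toNNReal _ (by linarith), dist_eq_norm, dist_eq_norm]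
    have : P x - P x' = (x - x') - (κ : 𝕜) • G (x - x') := by
      simp only [P, ← hGsub, smul_sub]
      abel
    rw [this]
    exact norm_sub_smul_le_of_coercive (B := L * T)
      (norm_integral_clm_family_le hKL hL ⟨hT, le_rfl⟩ (norm_nonneg _) fun _ _ => le_rfl)
      (hco _) hκ.le (by linarith) h3
  have hx : P (ContractingWith.fixedPoint P hP) = ContractingWith.fixedPoint P hP :=
    hP.fixedPoint_isFixedPt
  refine ⟨ContractingWith.fixedPoint P hP, ?_⟩
  have hκ0 : (κ : 𝕜) ≠ 0 := RCLike.ofReal_ne_zero.2 hκ.ne'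
  exact sub_eq_zero.1 ((smul_eq_zero.1 (sub_eq_self.1 hx)).resolve_left hκ0)

end Coercive

/-! ### Observers in the frame moving with the group. -/

section Observer

variable {𝕜 X Y : Type*} [RCLike 𝕜] [NormedAddCommGroup X]

section MildSolution

variable [NormedSpace 𝕜 X]

theorem UnitaryGroup.intervalIntegrable_neg_apply (U : UnitaryGroup 𝕜 X) {g : ℝ → X} {a b : ℝ}
    (hg : IntervalIntegrable g volume a b) :
    IntervalIntegrable (fun s => U (-s) (g s)) volume a b :=
  hg.clm_family_apply (Φ := fun s => U (-s)) (M := 1)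
    (U.continuous_apply continuous_fst.neg continuous_snd) fun s x => by rw [U.norm_map', one_mul]

variable [NormedSpace ℝ X] [CompleteSpace X]
  {S R : C0Semigroup 𝕜 X} {U : UnitaryGroup 𝕜 X}

theorem IntervalIntegrable.mono_Icc {E : Type*} [NormedAddCommGroup E] {g : ℝ → E} {T : ℝ}
    (hg : IntervalIntegrable g volume 0 T) {t : ℝ} (ht : t ∈ Set.Icc 0 T) :
    IntervalIntegrable g volume 0 t :=
  hg.mono_set (by
    rw [Set.uIcc_of_le ht.1, Set.uIcc_of_le (ht.1.trans ht.2)]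
    exact Set.Icc_subset_Icc le_rfl ht.2)

theorem IntervalIntegrable.reflect {E : Type*} [NormedAddCommGroup E] {g : ℝ → E} {T : ℝ}
    (hg : IntervalIntegrable g volume 0 T) :
    IntervalIntegrable (fun s => g (T - s)) volume 0 T := by
  have := (hg.comp_sub_left T).symm
  simpa using this

namespace UnitaryGroup

theorem integral_semigroup_eq (hU : ∀ t, 0 ≤ t → U t = S t) {g : ℝ → X} {t : ℝ} (ht : 0 ≤ t)
    (hg : IntervalIntegrable g volume 0 t) :
    ∫ s in (0 : ℝ)..t, S (t - s) (g s) = U t (∫ s in (0 : ℝ)..t, U (-s) (g s)) := by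
  rw [← (U t).intervalIntegral_comp_comm (U.intervalIntegrable_neg_apply hg)]
  refine intervalIntegral.integral_congr fun s hs => ?_
  rw [Set.uIcc_of_le ht] at hs
  rw [U.apply_apply, ← sub_eq_add_neg, hU _ (sub_nonneg.2 hs.2)]

/-- In the moving frame a mild solution is a plain primitive; neither the generator nor the
convolution remains. -/
theorem isMildSolution_iff (hU : ∀ t, 0 ≤ t → U t = S t) {T : ℝ} {g z : ℝ → X} :
    IsMildSolution S T g z ↔ ContinuousOn z (Set.Icc 0 T) ∧ IntervalIntegrable g volume 0 T ∧
      ∀ t ∈ Set.Icc 0 T, U (-t) (z t) = z 0 + ∫ s in (0 : ℝ)..t, U (-s) (g s) := by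
  have key : IntervalIntegrable g volume 0 T → ∀ t ∈ Set.Icc 0 T,
      (z t = S t (z 0) + ∫ s in (0 : ℝ)..t, S (t - s) (g s) ↔
        U (-t) (z t) = z 0 + ∫ s in (0 : ℝ)..t, U (-s) (g s)) := fun hg t ht => by
    rw [integral_semigroup_eq hU ht.1 (hg.mono_Icc ht), ← hU t ht.1, ← map_add]
    exact ⟨fun h => by rw [h, U.neg_apply_apply], fun h => by rw [← h, U.apply_neg_apply]⟩
  exact ⟨fun h => ⟨h.continuousOn, h.integrable, fun t ht => (key h.integrable t ht).1 (h.eq t ht)⟩,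
    fun h => ⟨h.1, h.2.1, fun t ht => (key h.2.1 t ht).2 (h.2.2 t ht)⟩⟩

theorem isMildSolution_openLoop (hU : ∀ t, 0 ≤ t → U t = S t) {T : ℝ} (hT : 0 ≤ T) {f : ℝ → X}
    (hf : IntervalIntegrable f volume 0 T) (x : X) :
    IsMildSolution S T f (openLoop S f x) := by
  have h0 : openLoop S f x 0 = x := by simp [openLoop, S.map_zero']
  have heq : ∀ t ∈ Set.Icc 0 T, openLoop S f x t = U t (x + ∫ s in (0 : ℝ)..t, U (-s) (f s)) :=
    fun t ht => by
      rw [openLoop, integral_semigroup_eq hU ht.1 (hf.mono_Icc ht), map_add, hU t ht.1]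
  refine ⟨?_, hf, fun t _ => by rw [h0, openLoop]⟩
  refine (U.continuousOn_apply continuous_id (continuousOn_const.add ?_)).congr heq
  have := intervalIntegral.continuousOn_primitive_interval
    (((intervalIntegrable_iff_integrableOn_Icc_of_le hT).1
      (U.intervalIntegrable_neg_apply hf)).mono_set (Set.uIcc_of_le hT).le)
  rwa [Set.uIcc_of_le hT] at this

/-- Lets every forward result serve the backward observer, with `U.reverse`, load `-f (T - ·)` and
output `y (T - ·)`. -/
theorem isMildSolution_reverse (hU : ∀ t, 0 ≤ t → U t = S t) (hR : ∀ t, 0 ≤ t → U (-t) = R t)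
    {T : ℝ} (hT : 0 ≤ T) {f z : ℝ → X} (h : IsMildSolution S T f z) :
    IsMildSolution R T (fun t => -f (T - t)) (fun t => z (T - t)) := by
  obtain ⟨hz, hf, heq⟩ := (isMildSolution_iff hU).1 h
  refine (isMildSolution_iff (U := U.reverse) hR).2 ⟨?_, hf.reflect.neg, fun t ht => ?_⟩
  · exact hz.comp (continuousOn_const.sub continuousOn_id)
      fun t ht => ⟨sub_nonneg.2 ht.2, sub_le_self _ ht.1⟩
  have ht' : T - t ∈ Set.Icc 0 T := ⟨sub_nonneg.2 ht.2, sub_le_self _ ht.1⟩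
  have h1 := heq (T - t) ht'
  have h2 := heq T ⟨hT, le_rfl⟩
  have hi := U.intervalIntegrable_neg_apply hf
  have hi1 := hi.mono_Icc ht'
  have h3 := intervalIntegral.integral_add_adjacent_intervals hi1 (hi1.symm.trans hi)
  have h4 : ∫ s in (0 : ℝ)..t, U.reverse (-s) (-f (T - s)) =
      -U T (∫ s in (T - t)..T, U (-s) (f s)) := by
    rw [← (U T).intervalIntegral_comp_comm (hi1.symm.trans hi), ← intervalIntegral.integral_neg]
    have h5 := intervalIntegral.integral_comp_sub_left (a := 0) (b := t)
      (fun s => -U T (U (-s) (f s))) T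
    rw [sub_zero] at h5
    rw [← h5]
    refine intervalIntegral.integral_congr fun s _ => ?_
    simp only [reverse_apply]
    rw [U.apply_apply, map_neg]
    congr 2
    ring_nf
  have h6 : ∫ s in (T - t)..T, U (-s) (f s) = U (-T) (z T) - U (-(T - t)) (z (T - t)) := by
    rw [h1, h2, ← h3]
    abel
  rw [h4, h6, map_sub, U.apply_neg_apply, U.apply_apply, reverse_apply, neg_neg, sub_zero]
  rw [show T + -(T - t) = t by ring]
  abel

end UnitaryGroup

end MildSolution

variable [InnerProductSpace 𝕜 X] [CompleteSpace X]
  [NormedAddCommGroup Y] [InnerProductSpace 𝕜 Y] [CompleteSpace Y]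

namespace UnitaryGroup

/-- The adjoint of the observation `x ↦ C (U s x)`. -/
noncomputable def obsAdjoint (U : UnitaryGroup 𝕜 X) (C : X →L[𝕜] Y) (s : ℝ) : Y →L[𝕜] X :=
  (U (-s)).comp (ContinuousLinearMap.adjoint C)

/-- The density of the observability Gramian. -/
noncomputable def gramDensity (U : UnitaryGroup 𝕜 X) (C : X →L[𝕜] Y) (s : ℝ) : X →L[𝕜] X :=
  (U.obsAdjoint C s).comp (C.comp (U s))

variable (U : UnitaryGroup 𝕜 X) (C : X →L[𝕜] Y)

theorem obsAdjoint_apply (s : ℝ) (v : Y) :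
    U.obsAdjoint C s v = U (-s) (ContinuousLinearMap.adjoint C v) := rfl

theorem gramDensity_apply (s : ℝ) (x : X) :
    U.gramDensity C s x = U.obsAdjoint C s (C (U s x)) := rfl

theorem inner_obsAdjoint (s : ℝ) (v : Y) (x : X) :
    inner 𝕜 (U.obsAdjoint C s v) x = inner 𝕜 v (C (U s x)) := by
  rw [obsAdjoint_apply, U.inner_apply_left, neg_neg, ContinuousLinearMap.adjoint_inner_left]

theorem continuous_obsAdjoint : Continuous fun p : ℝ × Y => U.obsAdjoint C p.1 p.2 :=
  U.continuous_apply continuous_fst.neg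
    ((ContinuousLinearMap.adjoint C).continuous.comp continuous_snd)

theorem norm_obsAdjoint_le (s : ℝ) (v : Y) :
    ‖U.obsAdjoint C s v‖ ≤ ‖ContinuousLinearMap.adjoint C‖ * ‖v‖ := by
  rw [obsAdjoint_apply, U.norm_map']
  exact ContinuousLinearMap.le_opNorm _ _

theorem continuous_gramDensity : Continuous fun p : ℝ × X => U.gramDensity C p.1 p.2 :=
  (U.continuous_obsAdjoint C).comp
    (continuous_fst.prodMk (C.continuous.comp U.continuous_uncurry))

theorem norm_gramDensity_le (s : ℝ) (x : X) :
    ‖U.gramDensity C s x‖ ≤ ‖ContinuousLinearMap.adjoint C‖ * ‖C‖ * ‖x‖ := by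
  refine (U.norm_obsAdjoint_le C s _).trans ?_
  rw [mul_assoc]
  gcongr
  exact (C.le_opNorm (U s x)).trans_eq (by rw [U.norm_map'])

theorem intervalIntegrable_obsAdjoint {v : ℝ → Y} {a b : ℝ}
    (hv : IntervalIntegrable v volume a b) :
    IntervalIntegrable (fun s => U.obsAdjoint C s (v s)) volume a b :=
  hv.clm_family_apply (U.continuous_obsAdjoint C) (U.norm_obsAdjoint_le C)

theorem re_inner_integral_obsAdjoint [NormedSpace ℝ X] {v : ℝ → Y} {a b : ℝ}
    (hv : IntervalIntegrable v volume a b) (x : X) :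
    RCLike.re (inner 𝕜 (∫ s in a..b, U.obsAdjoint C s (v s)) x) =
      ∫ s in a..b, RCLike.re (inner 𝕜 (v s) (C (U s x))) := by
  have hi := U.intervalIntegrable_obsAdjoint C hv
  rw [inner_re_symm, ← innerSL_apply_apply, ← ContinuousLinearMap.intervalIntegral_comp_comm _ hi]
  have hi2 : IntervalIntegrable (fun s => innerSL 𝕜 x (U.obsAdjoint C s (v s))) volume a b :=
    ⟨(innerSL 𝕜 x).integrable_comp hi.1, (innerSL 𝕜 x).integrable_comp hi.2⟩
  rw [← RCLike.reCLM_apply, ← ContinuousLinearMap.intervalIntegral_comp_comm _ hi2]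
  refine intervalIntegral.integral_congr fun s _ => ?_
  simp only [RCLike.reCLM_apply, innerSL_apply_apply]
  rw [inner_re_symm, U.inner_obsAdjoint]

/-- Turns observability into coercivity of the Gramian. -/
theorem re_inner_integral_gramDensity [NormedSpace ℝ X] (a b : ℝ) (x : X) :
    RCLike.re (inner 𝕜 (∫ s in a..b, U.gramDensity C s x) x) =
      ∫ s in a..b, ‖C (U s x)‖ ^ 2 := by
  have hc : Continuous fun s => C (U s x) := C.continuous.comp (U.continuous' x)
  simp only [gramDensity_apply]
  rw [U.re_inner_integral_obsAdjoint C (hc.intervalIntegrable _ _)]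
  simp only [inner_self_eq_norm_sq]

end UnitaryGroup

variable [NormedSpace ℝ X] {S R : C0Semigroup 𝕜 X} {U : UnitaryGroup 𝕜 X} {C : X →L[𝕜] Y}

/-- The feedback is a bounded perturbation: in the moving frame the closed loop is a Volterra
equation with kernel `-κ` times the Gramian density, and `f`, `y` enter only through a continuous
primitive. -/
theorem UnitaryGroup.exists_isMildSolution_nudging (hU : ∀ t, 0 ≤ t → U t = S t) {T : ℝ}
    (hT : 0 ≤ T) {f : ℝ → X} (hf : IntervalIntegrable f volume 0 T) {y : ℝ → Y}
    (hy : IntervalIntegrable y volume 0 T) (κ : ℝ) (x : X) :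
    ∃ z, IsMildSolution S T
      (fun t => f t + (κ : 𝕜) • ContinuousLinearMap.adjoint C (y t - C (z t))) z ∧ z 0 = x := by
  let K : ℝ → X →L[𝕜] X := fun s => -(κ : 𝕜) • U.gramDensity C s
  have hK : Continuous fun p : ℝ × X => K p.1 p.2 :=
    continuous_const.smul (U.continuous_gramDensity C)
  have hKapp : ∀ s v, K s v = -((κ : 𝕜) • U.gramDensity C s v) := fun s v => neg_smul _ _
  have hKL : ∀ s v, ‖K s v‖ ≤ |κ| * (‖ContinuousLinearMap.adjoint C‖ * ‖C‖) * ‖v‖ := fun s v => by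
    rw [hKapp, norm_neg, norm_smul, RCLike.norm_ofReal]
    rw [mul_assoc]
    gcongr
    exact U.norm_gramDensity_le C s v
  let g : ℝ → X := fun s => U (-s) (f s) + (κ : 𝕜) • U.obsAdjoint C s (y s)
  have hg : IntervalIntegrable g volume 0 T :=
    (U.intervalIntegrable_neg_apply hf).add ((U.intervalIntegrable_obsAdjoint C hy).smul (κ : 𝕜))
  have ha : ContinuousOn (fun t => x + ∫ s in (0 : ℝ)..t, g s) (Set.Icc 0 T) := by
    refine continuousOn_const.add ?_
    have := intervalIntegral.continuousOn_primitive_interval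
      ((intervalIntegrable_iff_integrableOn_Icc_of_le hT).1 hg |>.mono_set (Set.uIcc_of_le hT).le)
    rwa [Set.uIcc_of_le hT] at this
  obtain ⟨w, hw, hwt⟩ := exists_volterra_solution hK (by positivity) hKL hT ha
  have hw0 : w 0 = x := by simpa using hwt 0 ⟨le_rfl, hT⟩
  have hz : ContinuousOn (fun t => U t (w t)) (Set.Icc 0 T) :=
    U.continuousOn_apply continuous_id hw
  have hCz : IntervalIntegrable (fun t => C (U t (w t))) volume 0 T := by
    refine ContinuousOn.intervalIntegrable ?_
    rw [Set.uIcc_of_le hT]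
    exact C.continuous.comp_continuousOn hz
  have hadj : ∀ v : ℝ → Y, IntervalIntegrable v volume 0 T →
      IntervalIntegrable (fun t => ContinuousLinearMap.adjoint C (v t)) volume 0 T := fun v hv =>
    ⟨(ContinuousLinearMap.adjoint C).integrable_comp hv.1,
      (ContinuousLinearMap.adjoint C).integrable_comp hv.2⟩
  refine ⟨fun t => U t (w t), (UnitaryGroup.isMildSolution_iff hU).2
    ⟨hz, hf.add ((hadj _ (hy.sub hCz)).smul (κ : 𝕜)), fun t ht => ?_⟩, ?_⟩
  · have hKw : IntervalIntegrable (fun s => K s (w s)) volume 0 t := by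
      refine ContinuousOn.intervalIntegrable ?_
      rw [Set.uIcc_of_le ht.1]
      exact (hK.comp_continuousOn (continuousOn_id.prodMk hw)).mono
        (Set.Icc_subset_Icc le_rfl ht.2)
    simp only
    rw [U.neg_apply_apply, hwt t ht, U.map_zero_apply, hw0, add_assoc,
      ← intervalIntegral.integral_add (hg.mono_Icc ht) hKw]
    congr 1
    refine intervalIntegral.integral_congr fun s _ => ?_
    simp only [g, hKapp, map_add, map_sub, map_smul, UnitaryGroup.obsAdjoint_apply,
      UnitaryGroup.gramDensity_apply, smul_sub]
    abel
  · simp only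
    rw [U.map_zero_apply, hw0]

/-- The load cancels in `z - zo`, and the residual `y - C zo` becomes a forcing whose integral
vanishes by `hopt`. -/
theorem UnitaryGroup.exists_observer_step (hU : ∀ t, 0 ≤ t → U t = S t) {T δ : ℝ} (hT : 0 ≤ T)
    (hδ : 0 < δ) (hobs : ∀ x, δ * ‖x‖ ^ 2 ≤ ∫ t in (0 : ℝ)..T, ‖C (U t x)‖ ^ 2)
    {f zo : ℝ → X} {y : ℝ → Y} (hy : IntervalIntegrable y volume 0 T)
    (hzo : IsMildSolution S T f zo)
    (hopt : ∫ s in (0 : ℝ)..T, U.obsAdjoint C s (y s - C (zo s)) = 0) :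
    ∃ κ₀ > (0 : ℝ), ∃ D, 0 ≤ D ∧ ∀ κ, 0 ≤ κ → κ ≤ κ₀ → ∀ z : ℝ → X, IsMildSolution S T
      (fun t => f t + (κ : 𝕜) • ContinuousLinearMap.adjoint C (y t - C (z t))) z →
      ‖z T - zo T‖ ≤ (1 - δ / 4 * κ) * ‖z 0 - zo 0‖ + D * κ ^ 2 := by
  obtain ⟨hzoc, hf, hzot⟩ := (isMildSolution_iff hU).1 hzo
  have hCint : ∀ u : ℝ → X, ContinuousOn u (Set.Icc 0 T) →
      IntervalIntegrable (fun s => C (u s)) volume 0 T := fun u hu => by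
    refine ContinuousOn.intervalIntegrable ?_
    rw [Set.uIcc_of_le hT]
    exact C.continuous.comp_continuousOn hu
  obtain ⟨κ₀, hκ₀, D, hD, hstep⟩ := exists_norm_le_of_nudging (U.continuous_gramDensity C)
    (by positivity) (U.norm_gramDensity_le C) hT hδ
    (fun x => (hobs x).trans_eq (U.re_inner_integral_gramDensity C 0 T x).symm)
    (U.intervalIntegrable_obsAdjoint C (hy.sub (hCint zo hzoc))) hopt
  refine ⟨κ₀, hκ₀, D, hD, fun κ hκ hκ' z hz => ?_⟩
  obtain ⟨hzc, hgz, hzt⟩ := (isMildSolution_iff hU).1 hz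
  have h0 : U (-0) (z 0 - zo 0) = z 0 - zo 0 := by rw [neg_zero, U.map_zero_apply]
  have h := hstep κ hκ hκ' (fun t => U (-t) (z t - zo t))
    (U.continuousOn_apply continuous_neg (hzc.sub hzoc)) (fun t ht => ?_)
  · simpa only [U.norm_map'] using h
  · rw [h0, map_sub, hzt t ht, hzot t ht, add_sub_add_comm,
      ← intervalIntegral.integral_sub ((U.intervalIntegrable_neg_apply hgz).mono_Icc ht)
        ((U.intervalIntegrable_neg_apply hf).mono_Icc ht),
      RCLike.ofReal_smul_eq_real_smul, ← intervalIntegral.integral_smul]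
    congr 1
    refine intervalIntegral.integral_congr fun s _ => ?_
    rw [gramDensity_apply, U.apply_neg_apply, ← map_sub, ← RCLike.ofReal_smul_eq_real_smul (𝕜 := 𝕜)]
    simp only [obsAdjoint_apply, map_add, map_sub, map_smul]
    abel_nf

end Observer

/-! ### The least-squares minimizer and the back and forth iteration. -/

section BackAndForthNudging

theorem openLoop_eq_add {𝕜 X : Type*} [RCLike 𝕜] [NormedAddCommGroup X] [NormedSpace 𝕜 X]
    [NormedSpace ℝ X] (S : C0Semigroup 𝕜 X) (f : ℝ → X) (x x' : X) (t : ℝ) :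
    openLoop S f x t = openLoop S f x' t + S t (x - x') := by
  simp only [openLoop, map_sub]
  abel

/-- Start from `U (-T) x` and reverse time; isometry preserves the constant `δ`. -/
theorem UnitaryGroup.observable_reverse {𝕜 X Y : Type*} [RCLike 𝕜] [NormedAddCommGroup X]
    [NormedSpace 𝕜 X] [NormedAddCommGroup Y] [NormedSpace 𝕜 Y] {U : UnitaryGroup 𝕜 X}
    {C : X →L[𝕜] Y} {T δ : ℝ}
    (hobs : ∀ x, δ * ‖x‖ ^ 2 ≤ ∫ t in (0 : ℝ)..T, ‖C (U t x)‖ ^ 2) (x : X) :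
    δ * ‖x‖ ^ 2 ≤ ∫ t in (0 : ℝ)..T, ‖C (U.reverse t x)‖ ^ 2 := by
  have h := hobs (U (-T) x)
  rw [U.norm_map'] at h
  refine h.trans_eq ?_
  have h2 := intervalIntegral.integral_comp_sub_left (a := 0) (b := T)
    (fun s => ‖C (U s (U (-T) x))‖ ^ 2) T
  rw [sub_self, sub_zero] at h2
  rw [← h2]
  refine intervalIntegral.integral_congr fun s _ => ?_
  rw [U.apply_apply, reverse_apply, show T - s + -T = -s by ring]

variable {𝕜 X Y : Type*} [RCLike 𝕜] [NormedAddCommGroup X] [InnerProductSpace 𝕜 X]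
  [CompleteSpace X] [NormedAddCommGroup Y] [InnerProductSpace 𝕜 Y]

theorem ContinuousOn.memLp_Icc {E : Type*} [NormedAddCommGroup E] {u : ℝ → E} {a b : ℝ}
    (hu : ContinuousOn u (Set.Icc a b)) (p : ENNReal) :
    MemLp u p (volume.restrict (Set.Icc a b)) := by
  obtain ⟨M, hM⟩ := isCompact_Icc.exists_bound_of_continuousOn hu
  exact MemLp.of_bound (hu.integrableOn_compact isCompact_Icc).aestronglyMeasurable M
    ((ae_restrict_iff' measurableSet_Icc).2 (Eventually.of_forall hM))

theorem integral_norm_sub_sq_eq {T : ℝ} (hT : 0 ≤ T) {ρ g : ℝ → Y}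
    (hρ : MemLp ρ 2 (volume.restrict (Set.Icc 0 T)))
    (hg : MemLp g 2 (volume.restrict (Set.Icc 0 T)))
    (h0 : ∫ s in (0 : ℝ)..T, RCLike.re (inner 𝕜 (ρ s) (g s)) = 0) :
    ∫ s in (0 : ℝ)..T, ‖ρ s - g s‖ ^ 2 =
      (∫ s in (0 : ℝ)..T, ‖ρ s‖ ^ 2) + ∫ s in (0 : ℝ)..T, ‖g s‖ ^ 2 := by
  have hint : ∀ {u : ℝ → Y}, MemLp u 2 (volume.restrict (Set.Icc 0 T)) →
      IntervalIntegrable (fun s => ‖u s‖ ^ 2) volume 0 T := fun hu =>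
    (intervalIntegrable_iff_integrableOn_Icc_of_le hT).2 hu.norm.integrable_sq
  -- Writing the cross term through squares avoids a separate integrability proof for the inner
  -- product.
  have hre : ∀ s, RCLike.re (inner 𝕜 (ρ s) (g s)) =
      (‖ρ s‖ ^ 2 + ‖g s‖ ^ 2 - ‖ρ s - g s‖ ^ 2) / 2 := fun s => by
    rw [norm_sub_sq (𝕜 := 𝕜)]
    ring
  simp only [hre] at h0
  rw [intervalIntegral.integral_div, intervalIntegral.integral_sub
    ((hint hρ).add (hint hg)) (hint (u := fun s => ρ s - g s) (hρ.sub hg)),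
    intervalIntegral.integral_add (hint hρ) (hint hg)] at h0
  linarith

variable [NormedSpace ℝ X] [CompleteSpace Y] {S R : C0Semigroup 𝕜 X} {U : UnitaryGroup 𝕜 X}
  {C : X →L[𝕜] Y}

/-- Pythagoras: `hopt` says that the residual at `xo` is orthogonal to every output of the free
motion. -/
theorem UnitaryGroup.outputCost_eq (hU : ∀ t, 0 ≤ t → U t = S t) {T : ℝ} (hT : 0 ≤ T)
    {f : ℝ → X} (hf : IntervalIntegrable f volume 0 T) {y : ℝ → Y}
    (hy : MemLp y 2 (volume.restrict (Set.Icc 0 T))) {xo : X}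
    (hopt : ∫ s in (0 : ℝ)..T, U.obsAdjoint C s (y s - C (openLoop S f xo s)) = 0) (x : X) :
    outputCost S C T f y x = outputCost S C T f y xo +
      (1 / 2) * ∫ s in (0 : ℝ)..T, ‖C (U s (x - xo))‖ ^ 2 := by
  have hρ : MemLp (fun s => y s - C (openLoop S f xo s)) 2 (volume.restrict (Set.Icc 0 T)) :=
    hy.sub (ContinuousOn.memLp_Icc (C.continuous.comp_continuousOn
      (isMildSolution_openLoop hU hT hf xo).continuousOn) 2)
  have hg : MemLp (fun s => C (U s (x - xo))) 2 (volume.restrict (Set.Icc 0 T)) :=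
    ContinuousOn.memLp_Icc (C.continuous.comp (U.continuous' _)).continuousOn 2
  have hρi : IntervalIntegrable (fun s => y s - C (openLoop S f xo s)) volume 0 T :=
    (intervalIntegrable_iff_integrableOn_Icc_of_le hT).2 (hρ.integrable one_le_two)
  have h0 := U.re_inner_integral_obsAdjoint C hρi (x - xo)
  rw [hopt, inner_zero_left, map_zero] at h0
  rw [outputCost, outputCost, ← mul_add, ← integral_norm_sub_sq_eq hT hρ hg h0.symm]
  congr 1
  refine intervalIntegral.integral_congr fun s hs => ?_
  rw [Set.uIcc_of_le hT] at hs
  rw [openLoop_eq_add S f x xo, hU s hs.1, map_add, sub_sub]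

/-- By affinity of the trajectory in its initial state this is `G xo = b`, with `b` built from the
output error of the zero initial state. -/
theorem UnitaryGroup.exists_integral_obsAdjoint_eq_zero (hU : ∀ t, 0 ≤ t → U t = S t)
    {T δ : ℝ} (hT : 0 ≤ T) (hδ : 0 < δ)
    (hobs : ∀ x, δ * ‖x‖ ^ 2 ≤ ∫ t in (0 : ℝ)..T, ‖C (U t x)‖ ^ 2)
    {f : ℝ → X} (hf : IntervalIntegrable f volume 0 T) {y : ℝ → Y}
    (hy : IntervalIntegrable y volume 0 T) :
    ∃ xo, ∫ s in (0 : ℝ)..T, U.obsAdjoint C s (y s - C (openLoop S f xo s)) = 0 := by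
  obtain ⟨xo, hxo⟩ := exists_integral_clm_family_eq (U.continuous_gramDensity C)
    (by positivity) (U.norm_gramDensity_le C) hT hδ
    (fun x => (hobs x).trans_eq (U.re_inner_integral_gramDensity C 0 T x).symm)
    (∫ s in (0 : ℝ)..T, U.obsAdjoint C s (y s - C (openLoop S f 0 s)))
  refine ⟨xo, ?_⟩
  have hz : IntervalIntegrable (fun s => C (openLoop S f 0 s)) volume 0 T := by
    refine ContinuousOn.intervalIntegrable ?_
    rw [Set.uIcc_of_le hT]
    exact C.continuous.comp_continuousOn (isMildSolution_openLoop hU hT hf 0).continuousOn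
  have hG : IntervalIntegrable (fun s => U.gramDensity C s xo) volume 0 T :=
    ((U.continuous_gramDensity C).comp
      (continuous_id.prodMk continuous_const)).intervalIntegrable _ _
  rw [← sub_eq_zero.2 hxo.symm, ← intervalIntegral.integral_sub
    (U.intervalIntegrable_obsAdjoint C (hy.sub hz)) hG]
  refine intervalIntegral.integral_congr fun s hs => ?_
  rw [Set.uIcc_of_le hT] at hs
  rw [openLoop_eq_add S f xo 0, sub_zero, ← hU s hs.1, gramDensity_apply, ← map_sub, map_add,
    sub_sub]

/-- Optimality survives time reversal, so the backward sweep also has no first-order forcing. -/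
theorem UnitaryGroup.integral_reverse_obsAdjoint {T : ℝ} {ρ : ℝ → Y}
    (hρ : IntervalIntegrable ρ volume 0 T) :
    ∫ s in (0 : ℝ)..T, U.reverse.obsAdjoint C s (ρ (T - s)) =
      U T (∫ s in (0 : ℝ)..T, U.obsAdjoint C s (ρ s)) := by
  rw [← (U T).intervalIntegral_comp_comm (U.intervalIntegrable_obsAdjoint C hρ)]
  have h2 := intervalIntegral.integral_comp_sub_left (a := 0) (b := T)
    (fun s => U T (U.obsAdjoint C s (ρ s))) T
  rw [sub_self, sub_zero] at h2
  rw [← h2]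
  refine intervalIntegral.integral_congr fun s _ => ?_
  simp only [obsAdjoint_apply, reverse_apply]
  rw [U.apply_apply]
  congr 2
  ring

theorem UnitaryGroup.exists_isBFN (hU : ∀ t, 0 ≤ t → U t = S t) (hR : ∀ t, 0 ≤ t → U (-t) = R t)
    {T : ℝ} (hT : 0 ≤ T) {f : ℝ → X} (hf : IntervalIntegrable f volume 0 T) {y : ℝ → Y}
    (hy : IntervalIntegrable y volume 0 T) (κ : ℕ → ℝ) (x₁ : X) :
    ∃ zp zm : ℕ → ℝ → X, IsBFN S R C T f y κ x₁ zp zm := by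
  choose F hF hF0 using fun j => exists_isMildSolution_nudging (C := C) hU hT hf hy (κ j)
  choose B hB hB0 using fun j => exists_isMildSolution_nudging (C := C) (U := U.reverse) hR hT
    hf.reflect.neg hy.reflect (κ j)
  let ξ : ℕ → X := Nat.rec x₁ fun j x => B j (F j x T) T
  exact ⟨fun j => F j (ξ j), fun j => B j (F j (ξ j) T), fun j => hF j _, fun j => hB j _,
    hF0 0 _, fun j => hF0 (j + 1) _, fun j => hB0 j _⟩

theorem UnitaryGroup.tendsto_of_isBFN (hU : ∀ t, 0 ≤ t → U t = S t)
    (hR : ∀ t, 0 ≤ t → U (-t) = R t) {T δ : ℝ} (hT : 0 ≤ T) (hδ : 0 < δ)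
    (hobs : ∀ x, δ * ‖x‖ ^ 2 ≤ ∫ t in (0 : ℝ)..T, ‖C (U t x)‖ ^ 2)
    {f zo : ℝ → X} {y : ℝ → Y} (hy : IntervalIntegrable y volume 0 T)
    (hzo : IsMildSolution S T f zo)
    (hopt : ∫ s in (0 : ℝ)..T, U.obsAdjoint C s (y s - C (zo s)) = 0)
    {κ : ℕ → ℝ} (hκ : ∀ j, 0 < κ j)
    (hκ_sum : Tendsto (fun n => ∑ j ∈ Finset.range n, κ j) atTop atTop)
    (hκ_sq : Summable (fun j => κ j ^ 2)) {x₁ : X} {zp zm : ℕ → ℝ → X}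
    (h : IsBFN S R C T f y κ x₁ zp zm) :
    Tendsto (fun j => zp j 0) atTop (𝓝 (zo 0)) := by
  have hCzo : IntervalIntegrable (fun s => C (zo s)) volume 0 T := by
    refine ContinuousOn.intervalIntegrable ?_
    rw [Set.uIcc_of_le hT]
    exact C.continuous.comp_continuousOn hzo.continuousOn
  obtain ⟨κ₁, hκ₁, D₁, hD₁, hfwd⟩ := exists_observer_step hU hT hδ hobs hy hzo hopt
  obtain ⟨κ₂, hκ₂, D₂, hD₂, hbwd⟩ := exists_observer_step (U := U.reverse) hR hT hδ
    (observable_reverse hobs) hy.reflect (isMildSolution_reverse hU hR hT hzo)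
    (by rw [integral_reverse_obsAdjoint (ρ := fun s => y s - C (zo s)) (hy.sub hCzo), hopt,
      map_zero])
  -- The sweep estimates need small gains, so they are available only eventually.
  have hκ0 : Tendsto κ atTop (𝓝 0) := by
    have := hκ_sq.tendsto_atTop_zero.sqrt
    simpa only [Real.sqrt_sq (hκ _).le, Real.sqrt_zero] using this
  rw [tendsto_iff_norm_sub_tendsto_zero]
  refine tendsto_zero_of_le_one_sub_mul_add (c := δ / 4) (D := D₁ + D₂) (fun _ => norm_nonneg _)
    (fun j => (hκ j).le) (by positivity) (by positivity) hκ_sum hκ_sq ?_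
  filter_upwards [hκ0.eventually (ge_mem_nhds hκ₁), hκ0.eventually (ge_mem_nhds hκ₂)]
    with j hj₁ hj₂
  have h1 := hfwd (κ j) (hκ j).le hj₁ (zp j) (h.forward j)
  have h2 := hbwd (κ j) (hκ j).le hj₂ (zm j) (h.backward j)
  rw [sub_self, sub_zero, h.backward_init j, ← h.forward_init j] at h2
  -- The contraction of the backward sweep is discarded; that of the forward sweep suffices.
  have h3 : 0 ≤ δ / 4 * κ j * ‖zp j T - zo T‖ :=
    mul_nonneg (mul_nonneg (by linarith) (hκ j).le) (norm_nonneg _)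
  linarith

end BackAndForthNudging

theorem mainTheorem1 {𝕜 X Y : Type*} [RCLike 𝕜]
    [NormedAddCommGroup X] [InnerProductSpace 𝕜 X] [CompleteSpace X] [NormedSpace ℝ X]
    [NormedAddCommGroup Y] [InnerProductSpace 𝕜 Y] [CompleteSpace Y]
    -- the generator, its semigroup, and the observation operator
    (A : X →ₗ.[𝕜] X) (S : C0Semigroup 𝕜 X) (hS : S.HasGenerator A) (hA : IsSkewAdjointOp A)
    (C : X →L[𝕜] Y)
    -- exact observability at time `T`
    (T : ℝ) (hT : 0 < T) (δ : ℝ) (hδ : 0 < δ)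
    (hobs : ∀ x : X, δ * ‖x‖ ^ 2 ≤ ∫ t in (0 : ℝ)..T, ‖C (S t x)‖ ^ 2)
    -- load and measurement
    (f : ℝ → X) (hf : IntervalIntegrable f volume 0 T)
    (y : ℝ → Y) (hy : MemLp y 2 (volume.restrict (Set.Icc 0 T)))
    -- observer gains
    (κ : ℕ → ℝ) (hκ : ∀ j, 0 < κ j)
    (hκ_sum : Tendsto (fun n => ∑ j ∈ Finset.range n, κ j) atTop atTop)
    (hκ_sq : Summable (fun j => κ j ^ 2)) :
    ∃ xo : X,
      -- `xo` is the unique minimizer of the cost function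
      (∀ x, outputCost S C T f y xo ≤ outputCost S C T f y x) ∧
      (∀ x, (∀ x', outputCost S C T f y x ≤ outputCost S C T f y x') → x = xo) ∧
      -- `-A` generates a semigroup, so that the backward observers make sense
      (∃ Sm : C0Semigroup 𝕜 X, Sm.HasGenerator (-A)) ∧
      -- from every starting vector, the iterates exist and the estimates converge to `xo`
      ∀ Sm : C0Semigroup 𝕜 X, Sm.HasGenerator (-A) → ∀ x₁ : X,
        (∃ zp zm : ℕ → ℝ → X, IsBFN S Sm C T f y κ x₁ zp zm) ∧
        ∀ zp zm : ℕ → ℝ → X, IsBFN S Sm C T f y κ x₁ zp zm →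
          Tendsto (fun j => zp j 0) atTop (𝓝 xo) ∧
          Tendsto (fun j => zm j T) atTop (𝓝 xo) := by
  have hR := hS.adjoint hA
  set R := S.adjoint fun _ ht x => hS.norm_map hA ht x
  have hA' : (- -A) = A := neg_neg A
  obtain ⟨U, hU, hUR⟩ := S.exists_unitaryGroup R (fun t ht => hS.apply_neg_apply hR hA ht)
    (fun t ht => hR.apply_neg_apply (hA'.symm ▸ hS) hA.neg ht) fun t ht => hS.norm_map hA ht
  have hyi : IntervalIntegrable y volume 0 T :=
    (intervalIntegrable_iff_integrableOn_Icc_of_le hT.le).2 (hy.integrable one_le_two)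
  have hobsU : ∀ x, δ * ‖x‖ ^ 2 ≤ ∫ t in (0 : ℝ)..T, ‖C (U t x)‖ ^ 2 := fun x => by
    refine (hobs x).trans_eq (intervalIntegral.integral_congr fun t ht => ?_)
    rw [Set.uIcc_of_le hT.le] at ht
    simp only [hU t ht.1]
  obtain ⟨xo, hopt⟩ := UnitaryGroup.exists_integral_obsAdjoint_eq_zero hU hT.le hδ hobsU hf hyi
  have hcost := UnitaryGroup.outputCost_eq hU hT.le hf hy hopt
  -- Quadratic growth away from `xo` yields both minimality and uniqueness.
  have hgrow : ∀ x, outputCost S C T f y xo + 1 / 2 * (δ * ‖x - xo‖ ^ 2) ≤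
      outputCost S C T f y x := fun x => by
    rw [hcost x]
    linarith [hobsU (x - xo)]
  have hzo0 : openLoop S f xo 0 = xo := by simp [openLoop, S.map_zero']
  refine ⟨xo, fun x => ?_, fun x hx => ?_, ⟨R, hR⟩, fun Sm hSm x₁ => ?_⟩
  · have : 0 ≤ δ * ‖x - xo‖ ^ 2 := by positivity
    linarith [hgrow x]
  · have h : δ * ‖x - xo‖ ^ 2 ≤ 0 := by linarith [hgrow x, hx xo]
    have h2 : ‖x - xo‖ ^ 2 = 0 := le_antisymm (nonpos_of_mul_nonpos_right h hδ) (sq_nonneg _)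
    exact sub_eq_zero.1 (norm_eq_zero.1 (pow_eq_zero_iff two_ne_zero |>.1 h2))
  -- Any semigroup generated by `-A` is the adjoint one, so the same `U` serves every `Sm`.
  · have hUSm : ∀ t, 0 ≤ t → U (-t) = Sm t := fun t ht => by
      rw [hUR t ht]
      exact ContinuousLinearMap.ext fun x => hR.eq_of_isSkewAdjointOp hSm hA.neg ht x
    refine ⟨UnitaryGroup.exists_isBFN hU hUSm hT.le hf hyi κ x₁, fun zp zm h => ?_⟩
    have hlim := UnitaryGroup.tendsto_of_isBFN hU hUSm hT.le hδ hobsU hyi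
      (UnitaryGroup.isMildSolution_openLoop hU hT.le hf xo) hopt hκ hκ_sum hκ_sq h
    rw [hzo0] at hlim
    exact ⟨hlim, (hlim.comp (tendsto_add_atTop_nat 1)).congr h.forward_init⟩
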